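/- Let $n_X,n_Z\ge 1$ and $m\ge 2$ be integers, and let $S(x,z)$ be a real homogeneous polynomial of degree $m$ in $(x,z)\in\mathbb R^{n_X}\times\mathbb R^{n_Z}$ satisfying the rank one condition: the mixed Hessian $S''_{xz}(x,z)=\bigl(\partial^2 S/\partial x_i\partial z_j\,(x,z)\bigr)_{1\le i\le n_X,\,1\le j\le n_Z}$ has rank at least $1$ (that is, at least one nonzero entry) at every $(x,z)\neq(0,0)$. Let $a\in C_0^\infty(\mathbb R^{n_X}\times\mathbb R^{n_Z})$ be a complex-valued amplitude, and for real $\lambda$ let $$T_\lambda f(x)=\int_{\mathbb R^{n_Z}} e^{i\lambda S(x,z)}\,a(x,z)\,f(z)\,dz,\qquad x\in\mathbb R^{n_X}.$$ Then there is a constant $C>0$, depending on $S$ and $a$ but not on $\lambda$, such that for every $\lambda\ge 2$ the operator $T_\lambda$ is bounded from $L^2(\mathbb R^{n_Z})$ to $L^2(\mathbb R^{n_X})$, with operator norm $$\|T_\lambda\|\le\begin{cases} C\lambda^{-(n_X+n_Z)/(2m)} & \text{if } m>n_X+n_Z,\\ C\lambda^{-1/2}\log\lambda & \text{if } m=n_X+n_Z,\\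 C\lambda^{-1/2} & \text{if } 2\le m<n_X+n_Z.\end{cases}$$ -/

import Mathlib

open MeasureTheory

open scoped ContDiff

namespace OscPhase

/-- The value `S(x, z)` of a real polynomial in the `nX + nZ` variables
`x_1, …, x_{nX}` (indexed by `Sum.inl`) and `z_1, …, z_{nZ}` (indexed by `Sum.inr`). -/
noncomputable def evalAt {nX nZ : ℕ} (S : MvPolynomial (Fin nX ⊕ Fin nZ) ℝ)
    (x : EuclideanSpace ℝ (Fin nX)) (z : EuclideanSpace ℝ (Fin nZ)) : ℝ :=
  MvPolynomial.eval (Sum.elim (fun i => x i) (fun j => z j)) S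

/-- The mixed Hessian `S''_{xz}(x, z)`: the `nX × nZ` matrix of the second partial derivatives
`∂² S / ∂x_i ∂z_j` at the point `(x, z)`. -/
noncomputable def mixedHessian {nX nZ : ℕ} (S : MvPolynomial (Fin nX ⊕ Fin nZ) ℝ)
    (x : EuclideanSpace ℝ (Fin nX)) (z : EuclideanSpace ℝ (Fin nZ)) :
    Matrix (Fin nX) (Fin nZ) ℝ :=
  Matrix.of fun i j =>
    evalAt (MvPolynomial.pderiv (Sum.inl i) (MvPolynomial.pderiv (Sum.inr j) S)) x z

/-- The rank one condition: `rank S''_{xz}(x, z) ≥ 1` at every `(x, z) ≠ (0, 0)`. -/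
def RankOneCondition {nX nZ : ℕ} (S : MvPolynomial (Fin nX ⊕ Fin nZ) ℝ) : Prop :=
  ∀ (x : EuclideanSpace ℝ (Fin nX)) (z : EuclideanSpace ℝ (Fin nZ)),
    (x, z) ≠ (0, 0) → 1 ≤ (mixedHessian S x z).rank

/-- The oscillatory integral `T_lam f(x) = ∫ e^{i lam S(x,z)} a(x,z) f(z) dz` over `ℝ^{nZ}`. -/
noncomputable def oscIntegral {nX nZ : ℕ} (S : MvPolynomial (Fin nX ⊕ Fin nZ) ℝ)
    (a : EuclideanSpace ℝ (Fin nX) × EuclideanSpace ℝ (Fin nZ) → ℂ) (lam : ℝ)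
    (f : EuclideanSpace ℝ (Fin nZ) → ℂ) (x : EuclideanSpace ℝ (Fin nX)) : ℂ :=
  ∫ z, Complex.exp (Complex.I * ((lam * evalAt S x z : ℝ) : ℂ)) * a (x, z) * f z

/-- The bounded operator `T : L²(ℝ^{nZ}) → L²(ℝ^{nX})` is the oscillatory integral operator
`T_lam` with phase `S` and amplitude `a`. This determines `T` uniquely. -/
def IsOscOperator {nX nZ : ℕ} (S : MvPolynomial (Fin nX ⊕ Fin nZ) ℝ)
    (a : EuclideanSpace ℝ (Fin nX) × EuclideanSpace ℝ (Fin nZ) → ℂ) (lam : ℝ)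
    (T : Lp ℂ 2 (volume : Measure (EuclideanSpace ℝ (Fin nZ))) →L[ℂ]
      Lp ℂ 2 (volume : Measure (EuclideanSpace ℝ (Fin nX)))) : Prop :=
  ∀ f : Lp ℂ 2 (volume : Measure (EuclideanSpace ℝ (Fin nZ))),
    ∀ᵐ x ∂(volume : Measure (EuclideanSpace ℝ (Fin nX))), T f x = oscIntegral S a lam f x

end OscPhase

namespace OscPhase

open Set Filter Topology

local notation "𝔼" n:max => EuclideanSpace ℝ (Fin n)

/-! Away from the origin some entry `∂²S/∂x_i∂z_j` of the mixed Hessian is nonzero, and one such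
entry already gives the decay `λ^(-1/2)`. Freeze all variables except `x_i` and `z_j` and consider
`T*T` in these two. Its kernel is an oscillatory integral in `x_i` whose phase has derivative at
least `cλ|t - t'|`, so two integrations by parts bound it by `C/(1 + λ²|t - t'|²)`, which has
integral `O(1/λ)` in `t'`. Schur's test gives the one-variable bound
(`lintegral_enorm_sq_oscillatory_le`); Cauchy–Schwarz over the frozen variables, which range over a
bounded set, gives the full one (`lintegral_enorm_sq_le_of_slices`). A partition of unity extends it
to compact sets that avoid the origin (`exists_kernelBound_away_from_zero`).

At the origin homogeneity takes over. Write `n = nX + nZ` and split the amplitude into shells `|w| ~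
2^(-j)` (`exists_kernelBound_dyadic`). Dilation by `2^j` moves a shell to a fixed one, turns `λ`
into `λ2^(-jm)` and gains `2^(-jn/2)`, so shell `j` contributes `λ^(-1/2) 2^(j(m-n)/2)`. The
constant is uniform in `j` because the dilated amplitudes belong to one smooth family in `δ = 2^(-j)
∈ [0, 1]`. The shells stop at `2^J ~ λ^(1/m)`, where the dilated `λ` is about 1; the remaining ball
is estimated by size alone, as `2^(-Jn/2)`. The three cases are a geometric sum of ratio greater
than, equal to or less than 1 (`exists_dyadic_sum_le`). -/

/-! ### Oscillatory integral operators in one variable -/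

/-- Two integrations by parts in a one-dimensional oscillatory integral whose phase is
non-stationary on the support of the amplitude. -/
theorem norm_integral_exp_mul_le {φ φ₁ φ₂ φ₃ : ℝ → ℝ} {ψ ψ₁ ψ₂ : ℝ → ℂ} {K : Set ℝ}
    {R B M μ : ℝ} (hμ : 0 < μ) (hB : 0 ≤ B) (hM : 0 ≤ M) (hR : 0 ≤ R)
    (hφ : ∀ s, HasDerivAt φ (φ₁ s) s) (hφ₁ : ∀ s, HasDerivAt φ₁ (φ₂ s) s)
    (hφ₂ : ∀ s, HasDerivAt φ₂ (φ₃ s) s) (hφ₃ : Measurable φ₃)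
    (hψ : ∀ s, HasDerivAt ψ (ψ₁ s) s) (hψ₁ : ∀ s, HasDerivAt ψ₁ (ψ₂ s) s)
    (hψ₂ : Measurable ψ₂) (hK : IsClosed K) (hKR : K ⊆ Icc (-R) R) (hK0 : ∀ s ∉ K, ψ s = 0)
    (hlow : ∀ s ∈ K, μ ≤ |φ₁ s|) (hφ₂B : ∀ s ∈ K, |φ₂ s| ≤ B * μ)
    (hφ₃B : ∀ s ∈ K, |φ₃ s| ≤ B * μ) (hψM : ∀ s ∈ K, ‖ψ s‖ ≤ M) (hψ₁M : ∀ s ∈ K, ‖ψ₁ s‖ ≤ M)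
    (hψ₂M : ∀ s ∈ K, ‖ψ₂ s‖ ≤ M) :
    ‖∫ s, Complex.exp (Complex.I * (φ s : ℂ)) * ψ s‖
      ≤ 2 * R * (M * (1 + 4 * B + 3 * B ^ 2)) / μ ^ 2 := by
  have hφc : Continuous φ := continuous_iff_continuousAt.2 fun s => (hφ s).continuousAt
  have hφ₁c : Continuous φ₁ := continuous_iff_continuousAt.2 fun s => (hφ₁ s).continuousAt
  have hφ₂c : Continuous φ₂ := continuous_iff_continuousAt.2 fun s => (hφ₂ s).continuousAt
  have hψc : Continuous ψ := continuous_iff_continuousAt.2 fun s => (hψ s).continuousAt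
  have hψ₁c : Continuous ψ₁ := continuous_iff_continuousAt.2 fun s => (hψ₁ s).continuousAt
  have hoff : ∀ s ∉ K, ψ =ᶠ[𝓝 s] 0 := fun s hs => by
    filter_upwards [hK.isOpen_compl.mem_nhds hs] with t ht using hK0 t ht
  have hoff₁ : ∀ s ∉ K, ψ₁ =ᶠ[𝓝 s] 0 := fun s hs => by
    filter_upwards [hK.isOpen_compl.mem_nhds hs] with t ht
    exact (hψ t).unique (((hasDerivAt_const t (0 : ℂ))).congr_of_eventuallyEq (hoff t ht))
  have hψ₁0 : ∀ s ∉ K, ψ₁ s = 0 := fun s hs => (hoff₁ s hs).eq_of_nhds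
  have hψ₂0 : ∀ s ∉ K, ψ₂ s = 0 := fun s hs =>
    (hψ₁ s).unique (((hasDerivAt_const s (0 : ℂ))).congr_of_eventuallyEq (hoff₁ s hs))
  set E : ℝ → ℂ := fun s => Complex.exp (Complex.I * (φ s : ℂ)) with hE
  have hEd : ∀ s, HasDerivAt E (E s * (Complex.I * φ₁ s)) s := fun s =>
    ((hφ s).ofReal_comp.const_mul Complex.I).cexp
  have hEn : ∀ s, ‖E s‖ = 1 := fun s => by
    simp only [hE, mul_comm Complex.I, Complex.norm_exp_ofReal_mul_I]
  have hEc : Continuous E := continuous_iff_continuousAt.2 fun s => (hEd s).continuousAt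
  -- `G` collects the boundary terms of two integrations by parts and `w = (ψ₁/φ₁² - ψφ₂/φ₁³)'` is
  -- what remains: `G' = Eψ + Ew`, hence `∫ Eψ = -∫ Ew` since `G` has compact support.
  set w : ℝ → ℂ := fun s => ψ₂ s / φ₁ s ^ 2 - 3 * ψ₁ s * φ₂ s / φ₁ s ^ 3 - ψ s * φ₃ s / φ₁ s ^ 3
    + 3 * ψ s * φ₂ s ^ 2 / φ₁ s ^ 4 with hw
  set G : ℝ → ℂ := fun s =>
    E s * (-Complex.I * ψ s / φ₁ s + ψ₁ s / φ₁ s ^ 2 - ψ s * φ₂ s / φ₁ s ^ 3) with hG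
  have hGd : ∀ s, HasDerivAt G (E s * ψ s + E s * w s) s := by
    intro s
    by_cases hs : s ∈ K
    · have h0 : (φ₁ s : ℂ) ≠ 0 := by
        have := hlow s hs
        intro h
        rw [Complex.ofReal_eq_zero] at h
        rw [h, abs_zero] at this
        linarith
      have d1 := (hφ₁ s).ofReal_comp
      have d2 := (hφ₂ s).ofReal_comp
      have e1 := ((hψ s).const_mul (-Complex.I)).div d1 h0
      have e2 := (hψ₁ s).div (d1.pow 2) (pow_ne_zero 2 h0)
      have e3 := ((hψ s).mul d2).div (d1.pow 3) (pow_ne_zero 3 h0)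
      have e4 := (hEd s).mul ((e1.add e2).sub e3)
      refine HasDerivAt.congr_deriv (f := G) e4 ?_
      simp only [hw, Pi.add_apply, Pi.sub_apply, Pi.mul_apply, Pi.div_apply, Pi.pow_apply]
      field_simp
      ring_nf
      simp only [Complex.I_sq]
      ring
    -- Off `K` the derivative `φ₁` may vanish, but `G` is identically zero near `s` because `K` is
    -- closed.
    · have hG0 : G =ᶠ[𝓝 s] 0 := by
        filter_upwards [hoff s hs, hoff₁ s hs] with t h1 h2
        simp [hG, h1, h2]
      have : E s * ψ s + E s * w s = 0 := by
        simp [hw, hK0 s hs, hψ₁0 s hs, hψ₂0 s hs]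
      rw [this]
      exact (hasDerivAt_const s (0 : ℂ)).congr_of_eventuallyEq hG0
  have hwb : ∀ s, ‖E s * w s‖ ≤
      (Icc (-R) R).indicator (fun _ => M * (1 + 4 * B + 3 * B ^ 2) / μ ^ 2) s := by
    intro s
    rw [norm_mul, hEn, one_mul]
    by_cases hs : s ∈ K
    · rw [indicator_of_mem (hKR hs)]
      have hl := hlow s hs
      have hp : 0 < |φ₁ s| := hμ.trans_le hl
      have hBμ : 0 ≤ B * μ := by positivity
      -- Measuring `φ₂` and `φ₃` against `|φ₁|` rather than `μ` makes all four terms of `w`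
      -- multiples of `|φ₁|⁻²`.
      have h2 : |φ₂ s| ≤ B * |φ₁ s| := (hφ₂B s hs).trans (by gcongr)
      have h3 : |φ₃ s| ≤ B * |φ₁ s| := (hφ₃B s hs).trans (by gcongr)
      have n1 : ‖ψ₂ s / φ₁ s ^ 2‖ ≤ M / |φ₁ s| ^ 2 := by
        rw [norm_div, norm_pow, Complex.norm_real, Real.norm_eq_abs]
        gcongr
        exact hψ₂M s hs
      have n2 : ‖3 * ψ₁ s * φ₂ s / φ₁ s ^ 3‖ ≤ 3 * M * (B * |φ₁ s|) / |φ₁ s| ^ 3 := by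
        rw [norm_div, norm_pow, norm_mul, norm_mul, Complex.norm_real, Complex.norm_real,
          Real.norm_eq_abs, Real.norm_eq_abs, Complex.norm_ofNat]
        gcongr
        exact hψ₁M s hs
      have n3 : ‖ψ s * φ₃ s / φ₁ s ^ 3‖ ≤ M * (B * |φ₁ s|) / |φ₁ s| ^ 3 := by
        rw [norm_div, norm_pow, norm_mul, Complex.norm_real, Complex.norm_real,
          Real.norm_eq_abs, Real.norm_eq_abs]
        gcongr
        exact hψM s hs
      have n4 : ‖3 * ψ s * φ₂ s ^ 2 / φ₁ s ^ 4‖ ≤ 3 * M * (B * |φ₁ s|) ^ 2 / |φ₁ s| ^ 4 := by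
        rw [norm_div, norm_pow, norm_mul, norm_mul, norm_pow, Complex.norm_real, Complex.norm_real,
          Real.norm_eq_abs, Real.norm_eq_abs, Complex.norm_ofNat]
        gcongr
        exact hψM s hs
      have hsum : ‖w s‖ ≤ M / |φ₁ s| ^ 2 + 3 * M * (B * |φ₁ s|) / |φ₁ s| ^ 3
          + M * (B * |φ₁ s|) / |φ₁ s| ^ 3 + 3 * M * (B * |φ₁ s|) ^ 2 / |φ₁ s| ^ 4 := by
        refine (norm_add_le _ _).trans (add_le_add ?_ n4)
        refine (norm_sub_le _ _).trans (add_le_add ?_ n3)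
        exact (norm_sub_le _ _).trans (add_le_add n1 n2)
      refine hsum.trans ?_
      have : M / |φ₁ s| ^ 2 + 3 * M * (B * |φ₁ s|) / |φ₁ s| ^ 3
          + M * (B * |φ₁ s|) / |φ₁ s| ^ 3 + 3 * M * (B * |φ₁ s|) ^ 2 / |φ₁ s| ^ 4
          = M * (1 + 4 * B + 3 * B ^ 2) / |φ₁ s| ^ 2 := by
        field_simp
        ring
      rw [this]
      gcongr
    · have : w s = 0 := by simp [hw, hK0 s hs, hψ₁0 s hs, hψ₂0 s hs]
      rw [this, norm_zero]
      exact indicator_nonneg (fun _ _ => by positivity) _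
  have hKc : IsCompact K := isCompact_Icc.of_isClosed_subset hK hKR
  have hcs : ∀ f : ℝ → ℂ, (∀ s ∉ K, f s = 0) → HasCompactSupport f := fun f hf =>
    HasCompactSupport.intro hKc hf
  have hind : Integrable
      ((Icc (-R) R).indicator (fun _ => M * (1 + 4 * B + 3 * B ^ 2) / μ ^ 2)) :=
    (integrable_indicator_iff measurableSet_Icc).2 (integrableOn_const (by simp))
  have iw : Integrable (fun s => E s * w s) := by
    refine hind.mono' (Measurable.aestronglyMeasurable ?_) (ae_of_all _ hwb)
    have := hEc.measurable
    have := hψc.measurable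
    have := hψ₁c.measurable
    have := hφ₁c.measurable
    have := hφ₂c.measurable
    simp only [hw]
    fun_prop
  have iψ : Integrable (fun s => E s * ψ s) :=
    (hEc.mul hψc).integrable_of_hasCompactSupport (hcs _ fun s hs => by simp [hK0 s hs])
  have iG : Integrable G := by
    refine Continuous.integrable_of_hasCompactSupport
      (continuous_iff_continuousAt.2 fun s => (hGd s).continuousAt) (hcs _ fun s hs => ?_)
    simp [hG, hK0 s hs, hψ₁0 s hs]
  have key := integral_eq_zero_of_hasDerivAt_of_integrable hGd (iψ.add iw) iG
  rw [integral_add iψ iw, add_eq_zero_iff_eq_neg] at key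
  rw [key, norm_neg]
  refine (norm_integral_le_of_norm_le hind (ae_of_all _ hwb)).trans (le_of_eq ?_)
  rw [integral_indicator measurableSet_Icc, setIntegral_const, Measure.real, Real.volume_Icc,
    ENNReal.toReal_ofReal (by linarith), smul_eq_mul]
  ring

/-- Schur's test for the Gram kernel of an integral operator. -/
theorem lintegral_enorm_sq_integral_le_of_gram {α β : Type*} [MeasurableSpace α]
    [MeasurableSpace β] {μ : Measure α} {ν : Measure β} [IsFiniteMeasure μ] [SFinite ν]
    {k : α → β → ℂ} (hk : Measurable (Function.uncurry k)) {M : ℝ} (hM : ∀ s t, ‖k s t‖ ≤ M)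
    {f : β → ℂ} (hfm : Measurable f) (hf : Integrable f ν) {G : β → β → ENNReal}
    (hGm : Measurable (Function.uncurry G)) (hGs : ∀ t t', G t t' = G t' t) {A : ENNReal}
    (hGA : ∀ t, ∫⁻ t', G t t' ∂ν ≤ A)
    (hG : ∀ t t', ‖∫ s, k s t * (starRingEnd ℂ) (k s t') ∂μ‖ₑ ≤ G t t') :
    ∫⁻ s, ‖∫ t, k s t * f t ∂ν‖ₑ ^ 2 ∂μ ≤ A * ∫⁻ t, ‖f t‖ₑ ^ 2 ∂ν := by
  set h : α → ℂ := fun s => ∫ t, k s t * f t ∂ν with hh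
  have hhm : StronglyMeasurable h := by
    refine StronglyMeasurable.integral_prod_right (f := fun s t => k s t * f t) ?_
    exact (hk.mul (hfm.comp measurable_snd)).stronglyMeasurable
  have hhb : ∀ s, ‖h s‖ ≤ M * ∫ t, ‖f t‖ ∂ν := fun s => by
    rw [← integral_const_mul]
    refine norm_integral_le_of_norm_le (hf.norm.const_mul M) (ae_of_all _ fun t => ?_)
    rw [norm_mul]
    gcongr
    exact hM s t
  have hsq : ∀ s, h s * (starRingEnd ℂ) (h s) = ((‖h s‖ ^ 2 : ℝ) : ℂ) := fun s => by
    rw [Complex.mul_conj, Complex.normSq_eq_norm_sq]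
  have hLHS : ∫⁻ s, ‖h s‖ₑ ^ 2 ∂μ = ‖∫ s, h s * (starRingEnd ℂ) (h s) ∂μ‖ₑ := by
    have i1 : Integrable (fun s => ‖h s‖ ^ 2) μ := by
      refine Integrable.of_bound (hhm.norm.pow 2).aestronglyMeasurable
        ((M * ∫ t, ‖f t‖ ∂ν) ^ 2) (ae_of_all _ fun s => ?_)
      rw [norm_pow, norm_norm]
      gcongr
      exact hhb s
    simp_rw [hsq]
    rw [integral_complex_ofReal, ← ofReal_norm, Complex.norm_real, Real.norm_of_nonneg
      (integral_nonneg fun s => by positivity),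
      ofReal_integral_eq_lintegral_ofReal i1 (ae_of_all _ fun s => by positivity)]
    refine lintegral_congr fun s => ?_
    rw [ENNReal.ofReal_pow (norm_nonneg _), ofReal_norm]
  -- `|h|²` is a double integral in `(t, t')`; Fubini moves the integral over `s` inside, where it
  -- becomes the Gram kernel.
  set q : α → β × β → ℂ := fun s p =>
    (k s p.1 * f p.1) * ((starRingEnd ℂ) (k s p.2) * (starRingEnd ℂ) (f p.2)) with hq
  have hprod : ∀ s, h s * (starRingEnd ℂ) (h s) = ∫ p, q s p ∂(ν.prod ν) := fun s => by
    simp only [hh, hq]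
    rw [← integral_conj, ← integral_prod_mul]
    simp only [map_mul]
  have hqi : Integrable (Function.uncurry q) (μ.prod (ν.prod ν)) := by
    have hff : Integrable (fun p : β × β => f p.1 * f p.2) (ν.prod ν) := hf.mul_prod hf
    have hff' : Integrable (fun p : α × (β × β) => M ^ 2 * ‖f p.2.1 * f p.2.2‖)
        (μ.prod (ν.prod ν)) := (hff.norm.comp_snd μ).const_mul _
    refine hff'.mono' (Measurable.aestronglyMeasurable ?_) (ae_of_all _ fun p => ?_)
    · simp only [hq, Function.uncurry_def]
      have m1 : Measurable fun p : α × (β × β) => k p.1 p.2.1 :=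
        hk.comp (measurable_fst.prodMk (measurable_fst.comp measurable_snd))
      have m2 : Measurable fun p : α × (β × β) => k p.1 p.2.2 :=
        hk.comp (measurable_fst.prodMk (measurable_snd.comp measurable_snd))
      have m3 : Measurable (starRingEnd ℂ) := Complex.continuous_conj.measurable
      exact (m1.mul (hfm.comp (by fun_prop))).mul
        ((m3.comp m2).mul (m3.comp (hfm.comp (by fun_prop))))
    · simp only [hq, Function.uncurry_def, norm_mul, RCLike.norm_conj]
      have b1 := hM p.1 p.2.1
      have b2 := hM p.1 p.2.2
      have hM0 : 0 ≤ M := (norm_nonneg _).trans b1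
      calc ‖k p.1 p.2.1‖ * ‖f p.2.1‖ * (‖k p.1 p.2.2‖ * ‖f p.2.2‖)
          ≤ M * ‖f p.2.1‖ * (M * ‖f p.2.2‖) := by gcongr
        _ = _ := by ring
  rw [hLHS]
  simp_rw [hprod]
  rw [integral_integral_swap hqi]
  have hin : ∀ p : β × β, ‖∫ s, q s p ∂μ‖ₑ ≤ G p.1 p.2 * (‖f p.1‖ₑ * ‖f p.2‖ₑ) := fun p => by
    have : ∀ s, q s p = (k s p.1 * (starRingEnd ℂ) (k s p.2)) *
        (f p.1 * (starRingEnd ℂ) (f p.2)) := fun s => by simp only [hq]; ring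
    simp_rw [this]
    rw [integral_mul_const, enorm_mul, enorm_mul, RCLike.enorm_conj]
    gcongr
    exact hG _ _
  -- Schur's test: this replaces `|f(t)||f(t')|` by squares, and the symmetry of `G` makes the two
  -- resulting halves equal.
  have htwo : ∀ a b : ENNReal, 2 * (a * b) ≤ a ^ 2 + b ^ 2 := fun a b => by
    wlog hab : a ≤ b generalizing a b
    · rw [mul_comm a, add_comm]
      exact this b a (le_of_not_ge hab)
    obtain ⟨c, rfl⟩ := exists_add_of_le hab
    have : a ^ 2 + (a + c) ^ 2 = 2 * (a * (a + c)) + c ^ 2 := by ring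
    rw [this]
    exact le_self_add
  have hfe : Measurable fun t => ‖f t‖ₑ ^ 2 := hfm.enorm.pow_const 2
  have hGf : Measurable fun p : β × β => G p.1 p.2 * ‖f p.1‖ₑ ^ 2 :=
    hGm.mul (hfe.comp measurable_fst)
  have hhalf : ∫⁻ p : β × β, G p.1 p.2 * ‖f p.1‖ₑ ^ 2 ∂(ν.prod ν) ≤ A * ∫⁻ t, ‖f t‖ₑ ^ 2 ∂ν := by
    rw [lintegral_prod _ hGf.aemeasurable,
      ← lintegral_const_mul _ hfe]
    refine lintegral_mono fun t => ?_
    simp only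
    have hGt : Measurable fun t' => G t t' := hGm.comp measurable_prodMk_left
    rw [lintegral_mul_const _ hGt]
    gcongr
    exact hGA t
  have hhalf' : ∫⁻ p : β × β, G p.1 p.2 * ‖f p.2‖ₑ ^ 2 ∂(ν.prod ν) ≤ A * ∫⁻ t, ‖f t‖ₑ ^ 2 ∂ν := by
    refine le_trans (le_of_eq ?_) hhalf
    rw [← lintegral_prod_swap]
    exact lintegral_congr fun p => by simp only [Prod.fst_swap, Prod.snd_swap, hGs p.1 p.2]
  have hfin : 2 * ‖∫ p, ∫ s, q s p ∂μ ∂(ν.prod ν)‖ₑ ≤ 2 * (A * ∫⁻ t, ‖f t‖ₑ ^ 2 ∂ν) := by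
    calc 2 * ‖∫ p, ∫ s, q s p ∂μ ∂(ν.prod ν)‖ₑ
        ≤ 2 * ∫⁻ p : β × β, G p.1 p.2 * (‖f p.1‖ₑ * ‖f p.2‖ₑ) ∂(ν.prod ν) := by
          gcongr
          exact (enorm_integral_le_lintegral_enorm _).trans (lintegral_mono hin)
      _ = ∫⁻ p : β × β, 2 * (G p.1 p.2 * (‖f p.1‖ₑ * ‖f p.2‖ₑ)) ∂(ν.prod ν) := by
          rw [lintegral_const_mul' _ _ (by simp)]
      _ ≤ ∫⁻ p : β × β, (G p.1 p.2 * ‖f p.1‖ₑ ^ 2 + G p.1 p.2 * ‖f p.2‖ₑ ^ 2) ∂(ν.prod ν) := by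
          refine lintegral_mono fun p => ?_
          simp only
          rw [← mul_add, mul_left_comm]
          gcongr
          exact htwo _ _
      _ ≤ _ := by
          rw [lintegral_add_left hGf, two_mul]
          exact add_le_add hhalf hhalf'
  exact (ENNReal.mul_le_mul_iff_right (by simp) (by simp)).1 hfin

theorem sq_lintegral_le {α : Type*} [MeasurableSpace α] (μ : Measure α) {g : α → ENNReal}
    (hg : Measurable g) : (∫⁻ x, g x ∂μ) ^ 2 ≤ μ univ * ∫⁻ x, g x ^ 2 ∂μ := by
  have h := ENNReal.lintegral_mul_le_Lp_mul_Lq μ Real.HolderConjugate.two_two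
    (f := fun _ => 1) (g := g) aemeasurable_const hg.aemeasurable
  simp only [Pi.mul_apply, one_mul, ENNReal.one_rpow, lintegral_one] at h
  have h2 : (∫⁻ x, g x ∂μ) ^ (2 : ℝ) ≤
      (μ univ ^ (1 / 2 : ℝ) * (∫⁻ x, g x ^ (2 : ℝ) ∂μ) ^ (1 / 2 : ℝ)) ^ (2 : ℝ) := by
    gcongr
  rw [ENNReal.mul_rpow_of_nonneg _ _ (by norm_num), ← ENNReal.rpow_mul, ← ENNReal.rpow_mul] at h2
  simpa using h2

/-- The Schur constant of the Gram majorant. The factor `1/λ` here bounds the squared norm, and so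
is the source of `λ^(-1/2)`. -/
theorem lintegral_inv_one_add_sq_comp {lam : ℝ} (hlam : 0 < lam) {C : ℝ} (hC : 0 ≤ C) (t : ℝ) :
    ∫⁻ t', ENNReal.ofReal (C / (1 + (lam * (t - t')) ^ 2)) = ENNReal.ofReal (C * Real.pi / lam) := by
  have hi : Integrable fun t' : ℝ => C * (1 + (lam * (t - t')) ^ 2)⁻¹ :=
    ((integrable_inv_one_add_sq.comp_mul_left' hlam.ne').comp_sub_left t).const_mul C
  simp_rw [div_eq_mul_inv]
  rw [← ofReal_integral_eq_lintegral_ofReal hi (ae_of_all _ fun t' => by positivity)]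
  congr 1
  rw [integral_const_mul, integral_sub_left_eq_self (fun y => (1 + (lam * y) ^ 2)⁻¹) volume t,
    Measure.integral_comp_mul_left (fun y => (1 + y ^ 2)⁻¹), integral_univ_inv_one_add_sq,
    abs_of_pos (inv_pos.2 hlam), smul_eq_mul]
  ring

/-- The one-dimensional oscillatory integral operator with non-degenerate phase. -/
theorem lintegral_enorm_sq_oscillatory_le {Φ Φ₁ Φ₂ Φ₃ : ℝ → ℝ → ℝ} {β β₁ β₂ : ℝ → ℝ → ℂ}
    {K : Set (ℝ × ℝ)} {R c D M lam : ℝ} (hR : 0 ≤ R) (hc : 0 < c) (hD : 0 ≤ D)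
    (hlam : 0 < lam)
    (hΦc : Continuous (Function.uncurry Φ)) (hβc : Continuous (Function.uncurry β))
    (hΦ : ∀ t s, HasDerivAt (fun s => Φ s t) (Φ₁ s t) s)
    (hΦ₁ : ∀ t s, HasDerivAt (fun s => Φ₁ s t) (Φ₂ s t) s)
    (hΦ₂ : ∀ t s, HasDerivAt (fun s => Φ₂ s t) (Φ₃ s t) s)
    (hΦ₃ : ∀ t, Measurable fun s => Φ₃ s t)
    (hβ : ∀ t s, HasDerivAt (fun s => β s t) (β₁ s t) s)
    (hβ₁ : ∀ t s, HasDerivAt (fun s => β₁ s t) (β₂ s t) s)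
    (hβ₂ : ∀ t, Measurable fun s => β₂ s t)
    (hK : IsClosed K) (hKR : K ⊆ Icc (-R) R ×ˢ Icc (-R) R) (hK0 : ∀ s t, (s, t) ∉ K → β s t = 0)
    (hlow : ∀ s t t', (s, t) ∈ K → (s, t') ∈ K → c * |t - t'| ≤ |Φ₁ s t - Φ₁ s t'|)
    (hup₂ : ∀ s t t', (s, t) ∈ K → (s, t') ∈ K → |Φ₂ s t - Φ₂ s t'| ≤ D * |t - t'|)
    (hup₃ : ∀ s t t', (s, t) ∈ K → (s, t') ∈ K → |Φ₃ s t - Φ₃ s t'| ≤ D * |t - t'|)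
    (hβM : ∀ s t, ‖β s t‖ ≤ M) (hβ₁M : ∀ s t, ‖β₁ s t‖ ≤ M) (hβ₂M : ∀ s t, ‖β₂ s t‖ ≤ M)
    {f : ℝ → ℂ} (hf : Measurable f) :
    ∫⁻ s, ‖∫ t, Complex.exp (Complex.I * ((lam * Φ s t : ℝ) : ℂ)) * β s t * f t‖ₑ ^ 2 ≤
      ENNReal.ofReal ((2 * R * (4 * M ^ 2 * (1 + 4 * (D / c) + 3 * (D / c) ^ 2)) / c ^ 2
        + 2 * R * M ^ 2 + 1) * Real.pi / lam) * ∫⁻ t, ‖f t‖ₑ ^ 2 := by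
  have hM : 0 ≤ M := (norm_nonneg _).trans (hβM 0 0)
  set C₁ : ℝ := 2 * R * (4 * M ^ 2 * (1 + 4 * (D / c) + 3 * (D / c) ^ 2)) / c ^ 2 with hC₁
  have hC₁0 : 0 ≤ C₁ := by positivity
  -- `C₁` bounds the Gram kernel times `λ²|t - t'|²` and `2RM²` bounds the kernel itself. The extra
  -- `1` keeps `C` positive, so that the right side is `⊤` when `∫ |f|²` is.
  set C : ℝ := C₁ + 2 * R * M ^ 2 + 1 with hC
  have hC0 : 0 < C := by positivity
  have hpos : 0 < C * Real.pi / lam := by positivity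
  by_cases htop : ∫⁻ t, ‖f t‖ₑ ^ 2 = ⊤
  · rw [htop, ENNReal.mul_top (by simpa using hpos)]
    exact le_top
  set J := Icc (-R) R with hJ
  set k : ℝ → ℝ → ℂ := fun s t => Complex.exp (Complex.I * ((lam * Φ s t : ℝ) : ℂ)) * β s t with hk
  have hk0 : ∀ s t, (s ∉ J ∨ t ∉ J) → k s t = 0 := fun s t h => by
    simp only [hk]
    rw [hK0 s t (fun h' => by have := hKR h'; simp only [mem_prod] at this; tauto), mul_zero]
  have hkn : ∀ s t, ‖k s t‖ = ‖β s t‖ := fun s t => by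
    simp only [hk, norm_mul, mul_comm Complex.I, Complex.norm_exp_ofReal_mul_I, one_mul]
  have hfJ : Integrable f (volume.restrict J) := by
    have hL2 : MemLp f 2 (volume.restrict J) := by
      refine ⟨hf.aestronglyMeasurable, ?_⟩
      have h2 := eLpNorm_nnreal_pow_eq_lintegral (μ := volume.restrict J) (f := f) (p := 2)
        (by norm_num)
      have h3 : ∫⁻ t in J, ‖f t‖ₑ ^ 2 < ⊤ :=
        (setLIntegral_le_lintegral _ _).trans_lt (lt_top_iff_ne_top.2 htop)
      simp only [NNReal.coe_ofNat, ENNReal.rpow_ofNat, ENNReal.coe_ofNat] at h2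
      rw [← h2] at h3
      exact (ENNReal.pow_lt_top_iff.1 h3).resolve_right (by norm_num)
    exact hL2.integrable (by norm_num)
  have hin : ∀ s, ∫ t, k s t * f t = ∫ t in J, k s t * f t := fun s =>
    (setIntegral_eq_integral_of_forall_compl_eq_zero fun t ht => by
      rw [hk0 s t (Or.inr ht), zero_mul]).symm
  have hout : ∫⁻ s, ‖∫ t, k s t * f t‖ₑ ^ 2 = ∫⁻ s in J, ‖∫ t in J, k s t * f t‖ₑ ^ 2 := by
    simp_rw [hin]
    rw [← lintegral_indicator measurableSet_Icc]
    refine lintegral_congr fun s => ?_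
    by_cases hs : s ∈ J
    · rw [indicator_of_mem hs]
    · rw [indicator_of_notMem hs]
      simp [hk0 s _ (Or.inl hs)]
  have hgram : ∀ t t', ‖∫ s in J, k s t * (starRingEnd ℂ) (k s t')‖ ≤
      C / (1 + (lam * (t - t')) ^ 2) := by
    intro t t'
    have e1 : ∫ s in J, k s t * (starRingEnd ℂ) (k s t') = ∫ s, k s t * (starRingEnd ℂ) (k s t') :=
      setIntegral_eq_integral_of_forall_compl_eq_zero fun s hs => by
        rw [hk0 s t (Or.inl hs), zero_mul]
    have e2 : ∀ s, k s t * (starRingEnd ℂ) (k s t') =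
        Complex.exp (Complex.I * ((lam * (Φ s t - Φ s t') : ℝ) : ℂ)) *
          (β s t * (starRingEnd ℂ) (β s t')) := fun s => by
      simp only [hk, map_mul, ← Complex.exp_conj, Complex.conj_I, Complex.conj_ofReal]
      rw [mul_mul_mul_comm, ← Complex.exp_add]
      congr 2
      push_cast
      ring
    have b1 : ‖∫ s in J, k s t * (starRingEnd ℂ) (k s t')‖ ≤ 2 * R * M ^ 2 := by
      refine (norm_setIntegral_le_of_norm_le_const (C := M ^ 2) (by simp [hJ]) fun s _ => ?_).trans
        (le_of_eq ?_)
      · rw [norm_mul, RCLike.norm_conj, hkn, hkn, sq]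
        exact mul_le_mul (hβM _ _) (hβM _ _) (norm_nonneg _) hM
      · rw [hJ, Measure.real, Real.volume_Icc, ENNReal.toReal_ofReal (by linarith)]
        ring
    have b2 : ‖∫ s in J, k s t * (starRingEnd ℂ) (k s t')‖ * (lam * (t - t')) ^ 2 ≤ C₁ := by
      rcases eq_or_ne t t' with rfl | hne
      · simpa using hC₁0
      have habs : 0 < |t - t'| := abs_pos.2 (sub_ne_zero.2 hne)
      have hconj : ∀ {g : ℝ → ℂ} {g' : ℂ} {s : ℝ}, HasDerivAt g g' s →
          HasDerivAt (fun s => (starRingEnd ℂ) (g s)) ((starRingEnd ℂ) g') s := fun h => h.star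
      have hconjm : Measurable (starRingEnd ℂ) := Complex.continuous_conj.measurable
      have mb : ∀ t, Measurable fun s => β s t := fun t =>
        (hβc.comp (by fun_prop : Continuous fun s : ℝ => (s, t))).measurable
      have mb1 : ∀ t, Measurable fun s => β₁ s t := fun t =>
        (continuous_iff_continuousAt.2 fun s => (hβ₁ t s).continuousAt).measurable
      have hmul : ∀ {x y : ℂ}, ‖x‖ ≤ M → ‖y‖ ≤ M → ‖x * (starRingEnd ℂ) y‖ ≤ M ^ 2 := by
        intro x y hx hy
        rw [norm_mul, RCLike.norm_conj, sq]
        exact mul_le_mul hx hy (norm_nonneg _) hM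
      -- The phase derivative is at least `μ = λc|t - t'|` and the next two are at most `(D/c)μ`, so
      -- `B = D/c` does not depend on `t`, `t'` or `λ`. The factor 4 counts the terms of `ψ₂`, each
      -- at most `M²`.
      have key := norm_integral_exp_mul_le
        (φ := fun s => lam * (Φ s t - Φ s t')) (φ₁ := fun s => lam * (Φ₁ s t - Φ₁ s t'))
        (φ₂ := fun s => lam * (Φ₂ s t - Φ₂ s t')) (φ₃ := fun s => lam * (Φ₃ s t - Φ₃ s t'))
        (ψ := fun s => β s t * (starRingEnd ℂ) (β s t'))
        (ψ₁ := fun s => β₁ s t * (starRingEnd ℂ) (β s t') + β s t * (starRingEnd ℂ) (β₁ s t'))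
        (ψ₂ := fun s => β₂ s t * (starRingEnd ℂ) (β s t') + β₁ s t * (starRingEnd ℂ) (β₁ s t')
          + (β₁ s t * (starRingEnd ℂ) (β₁ s t') + β s t * (starRingEnd ℂ) (β₂ s t')))
        (K := {s | (s, t) ∈ K ∧ (s, t') ∈ K}) (R := R) (B := D / c) (M := 4 * M ^ 2)
        (μ := lam * (c * |t - t'|)) (by positivity) (by positivity) (by positivity) hR
        (fun s => ((hΦ t s).sub (hΦ t' s)).const_mul lam)
        (fun s => ((hΦ₁ t s).sub (hΦ₁ t' s)).const_mul lam)
        (fun s => ((hΦ₂ t s).sub (hΦ₂ t' s)).const_mul lam)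
        (((hΦ₃ t).sub (hΦ₃ t')).const_mul lam)
        (fun s => (hβ t s).mul (hconj (hβ t' s)))
        (fun s => ((hβ₁ t s).mul (hconj (hβ t' s))).add ((hβ t s).mul (hconj (hβ₁ t' s))))
        ((((hβ₂ t).mul (hconjm.comp (mb t'))).add ((mb1 t).mul (hconjm.comp (mb1 t')))).add
          (((mb1 t).mul (hconjm.comp (mb1 t'))).add ((mb t).mul (hconjm.comp (hβ₂ t')))))
        ((hK.preimage (by fun_prop : Continuous fun s : ℝ => (s, t))).inter
          (hK.preimage (by fun_prop : Continuous fun s : ℝ => (s, t'))))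
        (fun s hs => (hKR hs.1).1)
        (fun s hs => by
          by_cases h1 : (s, t) ∈ K
          · have h2 : (s, t') ∉ K := fun h2 => hs ⟨h1, h2⟩
            simp [hK0 s t' h2]
          · simp [hK0 s t h1])
        (fun s hs => by
          rw [abs_mul, abs_of_pos hlam]
          exact mul_le_mul_of_nonneg_left (hlow s t t' hs.1 hs.2) hlam.le)
        (fun s hs => by
          rw [abs_mul, abs_of_pos hlam]
          refine (mul_le_mul_of_nonneg_left (hup₂ s t t' hs.1 hs.2) hlam.le).trans (le_of_eq ?_)
          field_simp)
        (fun s hs => by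
          rw [abs_mul, abs_of_pos hlam]
          refine (mul_le_mul_of_nonneg_left (hup₃ s t t' hs.1 hs.2) hlam.le).trans (le_of_eq ?_)
          field_simp)
        (fun s _ => (hmul (hβM _ _) (hβM _ _)).trans (by nlinarith [sq_nonneg M]))
        (fun s _ => ((norm_add_le _ _).trans (add_le_add (hmul (hβ₁M _ _) (hβM _ _))
          (hmul (hβM _ _) (hβ₁M _ _)))).trans (by nlinarith [sq_nonneg M]))
        (fun s _ => ((norm_add_le _ _).trans (add_le_add
          ((norm_add_le _ _).trans (add_le_add (hmul (hβ₂M _ _) (hβM _ _))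
            (hmul (hβ₁M _ _) (hβ₁M _ _))))
          ((norm_add_le _ _).trans (add_le_add (hmul (hβ₁M _ _) (hβ₁M _ _))
            (hmul (hβM _ _) (hβ₂M _ _)))))).trans (by nlinarith [sq_nonneg M]))
      rw [e1]
      simp_rw [e2]
      have hne' : (lam * (t - t')) ^ 2 = (lam * |t - t'|) ^ 2 := by
        rw [mul_pow, mul_pow, sq_abs]
      rw [hne', ← le_div_iff₀ (by positivity)]
      refine key.trans (le_of_eq ?_)
      rw [hC₁]
      field_simp
    rw [le_div_iff₀ (by positivity)]
    linarith [mul_add ‖∫ s in J, k s t * (starRingEnd ℂ) (k s t')‖ 1 ((lam * (t - t')) ^ 2)]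
  have hkm : Measurable (Function.uncurry k) := by
    refine Continuous.measurable ?_
    simp only [hk, Function.uncurry_def] at hΦc hβc ⊢
    fun_prop
  have main := lintegral_enorm_sq_integral_le_of_gram (μ := volume.restrict J)
    (ν := volume.restrict J) hkm (M := M) (fun s t => (hkn s t).trans_le (hβM s t)) hf hfJ
    (G := fun t t' => ENNReal.ofReal (C / (1 + (lam * (t - t')) ^ 2)))
    (by simp only [Function.uncurry_def]; fun_prop)
    (fun t t' => by
      congr 3
      ring)
    (A := ENNReal.ofReal (C * Real.pi / lam))
    (fun t => (setLIntegral_le_lintegral _ _).trans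
      (lintegral_inv_one_add_sq_comp hlam hC0.le t).le)
    (fun t t' => by
      rw [← ofReal_norm]
      exact ENNReal.ofReal_le_ofReal (hgram t t'))
  rw [hout]
  refine main.trans ?_
  gcongr
  exact Measure.restrict_le_self

/-! ### From slices to the whole operator, and `L²` bounds for kernels -/

/-- An operator bound on one-dimensional slices gives a bound for the whole operator when the
kernel vanishes unless the remaining variables lie in sets of finite measure. -/
theorem lintegral_enorm_sq_le_of_slices {X Z : Type*} [MeasurableSpace X] [MeasurableSpace Z]
    {μ : Measure X} {ν : Measure Z} [SFinite μ] [SFinite ν] {k : ℝ × X → ℝ × Z → ℂ}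
    (hk : Measurable (Function.uncurry k)) {P : Set X} {Q : Set Z} (hP : MeasurableSet P)
    (hkP : ∀ x z, x.2 ∉ P → k x z = 0) (hkQ : ∀ x z, z.2 ∉ Q → k x z = 0)
    {A : ENNReal}
    (hA : ∀ x z, ∀ f : ℝ → ℂ, Measurable f →
      ∫⁻ s, ‖∫ t, k (s, x) (t, z) * f t‖ₑ ^ 2 ≤ A * ∫⁻ t, ‖f t‖ₑ ^ 2)
    {f : ℝ × Z → ℂ} (hf : Measurable f)
    (hi : ∀ x, Integrable (fun z => k x z * f z) (volume.prod ν)) :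
    ∫⁻ x, ‖∫ z, k x z * f z ∂(volume.prod ν)‖ₑ ^ 2 ∂(volume.prod μ)
      ≤ μ P * ν Q * A * ∫⁻ z, ‖f z‖ₑ ^ 2 ∂(volume.prod ν) := by
  set h : ℝ → X → Z → ℂ := fun s x z => ∫ t, k (s, x) (t, z) * f (t, z) with hh
  have hhm : Measurable fun p : (ℝ × X) × Z => h p.1.1 p.1.2 p.2 := by
    refine StronglyMeasurable.measurable ?_
    refine StronglyMeasurable.integral_prod_right
      (f := fun (p : (ℝ × X) × Z) (t : ℝ) => k (p.1.1, p.1.2) (t, p.2) * f (t, p.2)) ?_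
    refine Measurable.stronglyMeasurable ?_
    refine Measurable.mul ?_ (hf.comp (by fun_prop))
    exact hk.comp (g := Function.uncurry k)
      (f := fun q : ((ℝ × X) × Z) × ℝ => ((q.1.1.1, q.1.1.2), (q.2, q.1.2))) (by fun_prop)
  have hh' : ∀ s x z, h s x z = ∫ t, k (s, x) (t, z) * f (t, z) := fun _ _ _ => rfl
  clear_value h
  -- Integrating in `t` first leaves an integral over `Q`, where Cauchy–Schwarz costs `ν Q`;
  -- integrating over `P` at the end costs `μ P`.
  have hpt : ∀ x : ℝ × X, ‖∫ z, k x z * f z ∂(volume.prod ν)‖ₑ ^ 2 ≤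
      P.indicator (fun x' => ν Q * ∫⁻ z in Q, ‖h x.1 x' z‖ₑ ^ 2 ∂ν) x.2 := by
    intro x
    by_cases hx : x.2 ∈ P
    · rw [indicator_of_mem hx, integral_prod_symm _ (hi x)]
      have e : ∫ z, (∫ t, k x (t, z) * f (t, z)) ∂ν = ∫ z in Q, h x.1 x.2 z ∂ν := by
        simp only [hh']
        refine (setIntegral_eq_integral_of_forall_compl_eq_zero fun z hz => ?_).symm
        simp [hkQ _ (_, z) hz]
      rw [e]
      refine le_trans (pow_le_pow_left₀ (zero_le) (enorm_integral_le_lintegral_enorm _) 2) ?_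
      refine (sq_lintegral_le _ ?_).trans (le_of_eq ?_)
      · exact (hhm.comp (by fun_prop : Measurable fun z : Z => (x, z))).enorm
      · rw [Measure.restrict_apply_univ]
    · rw [indicator_of_notMem hx]
      simp [hkP x _ hx]
  have hm3 : Measurable fun p : (ℝ × X) × Z => ‖h p.1.1 p.1.2 p.2‖ₑ ^ 2 := hhm.enorm.pow_const 2
  have hsl : ∀ x, ∫⁻ s, ∫⁻ z in Q, ‖h s x z‖ₑ ^ 2 ∂ν ≤ A * ∫⁻ z, ‖f z‖ₑ ^ 2 ∂(volume.prod ν) := by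
    intro x
    have hm5 : Measurable (Function.uncurry fun s z => ‖h s x z‖ₑ ^ 2) :=
      hm3.comp (by fun_prop : Measurable fun p : ℝ × Z => ((p.1, x), p.2))
    rw [lintegral_lintegral_swap hm5.aemeasurable]
    have hfe : Measurable fun z => ‖f z‖ₑ ^ 2 := hf.enorm.pow_const 2
    rw [lintegral_prod_symm _ hfe.aemeasurable,
      ← lintegral_const_mul _ hfe.lintegral_prod_left']
    refine (setLIntegral_le_lintegral _ _).trans (lintegral_mono fun z => ?_)
    simp only [hh']
    exact hA x z _ (hf.comp (by fun_prop))
  have hm2 : Measurable fun x : ℝ × X => ∫⁻ z in Q, ‖h x.1 x.2 z‖ₑ ^ 2 ∂ν := hm3.lintegral_prod_right'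
  refine (lintegral_mono hpt).trans ?_
  have hm4 : Measurable fun x : ℝ × X =>
      P.indicator (fun x' => ν Q * ∫⁻ z in Q, ‖h x.1 x' z‖ₑ ^ 2 ∂ν) x.2 :=
    (hm2.const_mul (ν Q)).indicator (measurable_snd hP)
  rw [lintegral_prod_symm _ hm4.aemeasurable]
  have : ∀ x : X, ∫⁻ s, P.indicator (fun x' => ν Q * ∫⁻ z in Q, ‖h s x' z‖ₑ ^ 2 ∂ν) x ≤
      P.indicator (fun _ => ν Q * (A * ∫⁻ z, ‖f z‖ₑ ^ 2 ∂(volume.prod ν))) x := by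
    intro x
    by_cases hx : x ∈ P
    · simp only [indicator_of_mem hx]
      have hm5 : Measurable fun s : ℝ => ∫⁻ z in Q, ‖h s x z‖ₑ ^ 2 ∂ν :=
        hm2.comp (measurable_id.prodMk measurable_const)
      rw [lintegral_const_mul _ hm5]
      gcongr
      exact hsl x
    · simp [indicator_of_notMem hx]
  refine (lintegral_mono this).trans (le_of_eq ?_)
  rw [lintegral_indicator_const hP]
  ring

/-- The integral operator with kernel `k` maps `L²` to `L²` with norm at most `A`. -/
def KernelBound {X Z : Type*} [MeasureSpace X] [MeasureSpace Z] (k : X × Z → ℂ) (A : ℝ) : Prop :=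
  ∀ f : Z → ℂ, Measurable f → MemLp f 2 →
    eLpNorm (fun x => ∫ z, k (x, z) * f z) 2 ≤ ENNReal.ofReal A * eLpNorm f 2

theorem eLpNorm_two_sq {α : Type*} [MeasurableSpace α] {μ : Measure α} (f : α → ℂ) :
    eLpNorm f 2 μ ^ 2 = ∫⁻ x, ‖f x‖ₑ ^ 2 ∂μ := by
  have h := eLpNorm_nnreal_pow_eq_lintegral (μ := μ) (f := f) (p := 2) (by norm_num)
  simpa only [NNReal.coe_ofNat, ENNReal.rpow_ofNat, ENNReal.coe_ofNat] using h

theorem kernelBound_of_sq {X Z : Type*} [MeasureSpace X] [MeasureSpace Z] {k : X × Z → ℂ} {A : ℝ}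
    (hA : 0 ≤ A) (h : ∀ f : Z → ℂ, Measurable f → MemLp f 2 →
      ∫⁻ x, ‖∫ z, k (x, z) * f z‖ₑ ^ 2 ≤ ENNReal.ofReal (A ^ 2) * ∫⁻ z, ‖f z‖ₑ ^ 2) :
    KernelBound k A := by
  intro f hf hf2
  have h1 := h f hf hf2
  rw [← eLpNorm_two_sq, ← eLpNorm_two_sq, ENNReal.ofReal_pow hA, ← mul_pow] at h1
  exact (ENNReal.pow_le_pow_left_iff (by norm_num)).1 h1

theorem hasCompactSupport_slice {X Z : Type*} [TopologicalSpace X] [TopologicalSpace Z]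
    [T2Space Z] {k : X × Z → ℂ} (hkc : HasCompactSupport k) (x : X) :
    HasCompactSupport fun z => k (x, z) := by
  refine HasCompactSupport.intro (hkc.isCompact.image continuous_snd) fun z hz => ?_
  by_contra h
  exact hz ⟨(x, z), subset_tsupport _ h, rfl⟩

theorem integrable_slice_mul {X Z : Type*} [TopologicalSpace X] [TopologicalSpace Z] [T2Space Z]
    [MeasureSpace Z] [OpensMeasurableSpace Z] [IsFiniteMeasureOnCompacts (volume : Measure Z)]
    {k : X × Z → ℂ} (hk : Continuous k) (hkc : HasCompactSupport k) {f : Z → ℂ} (hf : MemLp f 2)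
    (x : X) : Integrable fun z => k (x, z) * f z :=
  MemLp.integrable_mul (p := 2) (q := 2)
    ((hk.comp (by fun_prop : Continuous fun z => (x, z))).memLp_of_hasCompactSupport
      (hasCompactSupport_slice hkc x)) hf

/-! ### Singling out one coordinate; derivatives along it -/

/-- Coordinates on `ℝ^{p+1}` that single out the coordinate `i`. -/
noncomputable def slice {p : ℕ} (i : Fin (p + 1)) :
    ℝ × (Fin p → ℝ) ≃ᵐ EuclideanSpace ℝ (Fin (p + 1)) :=
  (MeasurableEquiv.piFinSuccAbove (fun _ => ℝ) i).symm.trans (MeasurableEquiv.toLp 2 _)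

theorem slice_apply_self {p : ℕ} (i : Fin (p + 1)) (y : ℝ × (Fin p → ℝ)) : slice i y i = y.1 := by
  change (Fin.insertNthEquiv (fun _ => ℝ) i) y i = y.1
  simp

theorem slice_apply_succAbove {p : ℕ} (i : Fin (p + 1)) (y : ℝ × (Fin p → ℝ)) (l : Fin p) :
    slice i y (i.succAbove l) = y.2 l := by
  change (Fin.insertNthEquiv (fun _ => ℝ) i) y (i.succAbove l) = y.2 l
  simp

theorem measurePreserving_slice {p : ℕ} (i : Fin (p + 1)) : MeasurePreserving (slice i) :=
  ((volume_preserving_piFinSuccAbove (fun _ => ℝ) i).symm).trans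
    (EuclideanSpace.volume_preserving_symm_measurableEquiv_toLp (Fin (p + 1))).symm

theorem slice_eq_add {p : ℕ} (i : Fin (p + 1)) (s : ℝ) (y : Fin p → ℝ) :
    slice i (s, y) = slice i (0, y) + s • EuclideanSpace.single i (1 : ℝ) := by
  ext l
  rcases Fin.eq_self_or_eq_succAbove i l with rfl | ⟨l, rfl⟩
  · simp [slice_apply_self]
  · simp [slice_apply_succAbove]

theorem continuous_slice {p : ℕ} (i : Fin (p + 1)) : Continuous (slice i) := by
  have : Continuous fun y : ℝ × (Fin p → ℝ) => (slice i y).ofLp := by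
    refine continuous_pi fun l => ?_
    rcases Fin.eq_self_or_eq_succAbove i l with rfl | ⟨l, rfl⟩
    · simp only [slice_apply_self]
      fun_prop
    · simp only [slice_apply_succAbove]
      fun_prop
  exact (PiLp.continuous_toLp 2 (fun _ : Fin (p + 1) => ℝ)).comp this

/-- Along a curve moving only coordinate `k`, at unit speed, formal and analytic derivatives agree:
both obey the Leibniz rule, so induction on the polynomial suffices. -/
theorem hasDerivAt_eval_curve {σ : Type*} [DecidableEq σ] {v : ℝ → σ → ℝ} {k : σ} {s : ℝ}
    (hv : ∀ l, HasDerivAt (fun s => v s l) (if l = k then 1 else 0) s) (P : MvPolynomial σ ℝ) :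
    HasDerivAt (fun s => MvPolynomial.eval (v s) P)
      (MvPolynomial.eval (v s) (MvPolynomial.pderiv k P)) s := by
  induction P using MvPolynomial.induction_on with
  | C a => simpa using hasDerivAt_const s a
  | add P Q hP hQ => simp only [map_add]; exact hP.add hQ
  | mul_X P l hP =>
    have := hP.mul (hv l)
    simp only [map_mul, MvPolynomial.eval_X, Derivation.leibniz, smul_eq_mul, map_add]
    refine this.congr_deriv ?_
    rw [MvPolynomial.pderiv_X, Pi.single_apply]
    split_ifs
    · simp only [map_one]; ring
    · simp only [map_zero]; ring

theorem hasDerivAt_evalAt_left {p q : ℕ} (S : MvPolynomial (Fin (p + 1) ⊕ Fin q) ℝ)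
    (i : Fin (p + 1)) (y : Fin p → ℝ) (z : EuclideanSpace ℝ (Fin q)) (s : ℝ) :
    HasDerivAt (fun s => evalAt S (slice i (s, y)) z)
      (evalAt (MvPolynomial.pderiv (Sum.inl i) S) (slice i (s, y)) z) s := by
  refine hasDerivAt_eval_curve (fun l => ?_) S
  rcases l with l | l
  · rcases Fin.eq_self_or_eq_succAbove i l with rfl | ⟨l, rfl⟩
    · simpa [slice_apply_self] using hasDerivAt_id' s
    · simpa [slice_apply_succAbove] using hasDerivAt_const s (y l)
  · simpa using hasDerivAt_const s (z l)

theorem hasDerivAt_evalAt_right {p q : ℕ} (S : MvPolynomial (Fin p ⊕ Fin (q + 1)) ℝ)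
    (j : Fin (q + 1)) (x : EuclideanSpace ℝ (Fin p)) (y : Fin q → ℝ) (t : ℝ) :
    HasDerivAt (fun t => evalAt S x (slice j (t, y)))
      (evalAt (MvPolynomial.pderiv (Sum.inr j) S) x (slice j (t, y))) t := by
  refine hasDerivAt_eval_curve (fun l => ?_) S
  rcases l with l | l
  · simpa using hasDerivAt_const t (x l)
  · rcases Fin.eq_self_or_eq_succAbove j l with rfl | ⟨l, rfl⟩
    · simpa [slice_apply_self] using hasDerivAt_id' t
    · simpa [slice_apply_succAbove] using hasDerivAt_const t (y l)

/-- The commutator of two derivations is a derivation, and this one kills every variable. -/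
theorem pderiv_comm {σ : Type*} (i j : σ) (P : MvPolynomial σ ℝ) :
    MvPolynomial.pderiv i (MvPolynomial.pderiv j P) =
      MvPolynomial.pderiv j (MvPolynomial.pderiv i P) := by
  classical
  have h : ⁅MvPolynomial.pderiv (R := ℝ) i, MvPolynomial.pderiv (R := ℝ) j⁆ = 0 := by
    refine MvPolynomial.derivation_ext fun l => ?_
    rw [Derivation.commutator_apply, MvPolynomial.pderiv_X, MvPolynomial.pderiv_X, Pi.single_apply,
      Pi.single_apply]
    split_ifs <;> simp
  have := congrArg (fun D => D P) h
  simp only [Derivation.commutator_apply, Derivation.coe_zero, Pi.zero_apply] at this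
  exact sub_eq_zero.1 this

theorem continuous_evalAt {p q : ℕ} (S : MvPolynomial (Fin p ⊕ Fin q) ℝ) :
    Continuous fun w : EuclideanSpace ℝ (Fin p) × EuclideanSpace ℝ (Fin q) =>
      evalAt S w.1 w.2 := by
  refine S.continuous_eval.comp (continuous_pi fun l => ?_)
  rcases l with l | l <;> simp only [Sum.elim_inl, Sum.elim_inr] <;> fun_prop

/-- The mean value theorem on an unordered interval. -/
theorem exists_sub_eq_mul_of_hasDerivAt {g g' : ℝ → ℝ} (hg : ∀ t, HasDerivAt g (g' t) t)
    (t t' : ℝ) : ∃ u ∈ segment ℝ t t', g t - g t' = g' u * (t - t') := by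
  wlog h : t < t' generalizing t t'
  · rcases (not_lt.1 h).eq_or_lt with rfl | h'
    · exact ⟨_, left_mem_segment ℝ _ _, by simp⟩
    · obtain ⟨u, hu, e⟩ := this t' t h'
      exact ⟨u, segment_symm ℝ t' t ▸ hu, by linarith⟩
  obtain ⟨u, hu, e⟩ := exists_hasDerivAt_eq_slope g g' h
    (fun s _ => (hg s).continuousAt.continuousWithinAt) fun s _ => hg s
  refine ⟨u, by rw [segment_eq_Icc h.le]; exact Ioo_subset_Icc_self hu, ?_⟩
  have : t' - t ≠ 0 := by linarith
  field_simp at e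
  linarith

/-- Keeps the intermediate point of the mean value theorem inside the region where the derivative is
controlled. -/
theorem slice_mem_of_mem_segment {q : ℕ} {V : Set (EuclideanSpace ℝ (Fin (q + 1)))}
    (hV : Convex ℝ V) {j : Fin (q + 1)} {y : Fin q → ℝ} {t t' u : ℝ} (h : slice j (t, y) ∈ V)
    (h' : slice j (t', y) ∈ V) (hu : u ∈ segment ℝ t t') : slice j (u, y) ∈ V := by
  obtain ⟨a, b, ha, hb, hab, rfl⟩ := hu
  have : slice j (a • t + b • t', y) = a • slice j (t, y) + b • slice j (t', y) := by
    rw [slice_eq_add j (a • t + b • t'), slice_eq_add j t, slice_eq_add j t', smul_add, smul_add,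
      add_add_add_comm, ← add_smul, hab, one_smul, smul_smul, smul_smul, ← add_smul]
    rfl
  rw [this]
  exact hV h h' ha hb hab

theorem slice_fst_mem_Icc {p : ℕ} {i : Fin (p + 1)} {y : ℝ × (Fin p → ℝ)} {R : ℝ}
    (h : ‖slice i y‖ ≤ R) : y.1 ∈ Icc (-R) R := by
  have := PiLp.norm_apply_le (slice i y) i
  rw [slice_apply_self, Real.norm_eq_abs] at this
  exact abs_le.1 (this.trans h)

theorem slice_snd_mem_Icc {p : ℕ} {i : Fin (p + 1)} {y : ℝ × (Fin p → ℝ)} {R : ℝ}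
    (h : ‖slice i y‖ ≤ R) : y.2 ∈ Icc (fun _ => -R) (fun _ => R) := by
  have hl : ∀ l, |y.2 l| ≤ R := fun l => by
    have := PiLp.norm_apply_le (slice i y) (i.succAbove l)
    rw [slice_apply_succAbove, Real.norm_eq_abs] at this
    exact this.trans h
  exact ⟨fun l => (abs_le.1 (hl l)).1, fun l => (abs_le.1 (hl l)).2⟩

/-- The derivative of a function on a product in a direction of the first factor. -/
noncomputable def dirDeriv {X Z : Type*} [NormedAddCommGroup X] [NormedSpace ℝ X]
    [NormedAddCommGroup Z] [NormedSpace ℝ Z] (v : X) (b : X × Z → ℂ) (w : X × Z) : ℂ :=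
  fderiv ℝ b w (v, 0)

theorem contDiff_dirDeriv {X Z : Type*} [NormedAddCommGroup X] [NormedSpace ℝ X]
    [NormedAddCommGroup Z] [NormedSpace ℝ Z] (v : X) {b : X × Z → ℂ} (hb : ContDiff ℝ ∞ b) :
    ContDiff ℝ ∞ (dirDeriv v b) :=
  (hb.fderiv_right (m := ∞) (by simp)).clm_apply contDiff_const

theorem hasDerivAt_slice {p : ℕ} {Z : Type*} [NormedAddCommGroup Z] [NormedSpace ℝ Z]
    {b : EuclideanSpace ℝ (Fin (p + 1)) × Z → ℂ} (hb : ContDiff ℝ ∞ b) (i : Fin (p + 1))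
    (y : Fin p → ℝ) (z : Z) (s : ℝ) :
    HasDerivAt (fun s => b (slice i (s, y), z))
      (dirDeriv (EuclideanSpace.single i 1) b (slice i (s, y), z)) s := by
  have h1 : HasDerivAt (fun s : ℝ => (slice i (s, y), z))
      ((EuclideanSpace.single i (1 : ℝ), (0 : Z))) s := by
    refine HasDerivAt.prodMk ?_ (hasDerivAt_const _ _)
    have h2 : (fun s => slice i (s, y)) =
        fun s => slice i (0, y) + s • EuclideanSpace.single i (1 : ℝ) :=
      funext fun s => slice_eq_add i s y
    rw [h2]
    simpa using ((hasDerivAt_id s).smul_const (EuclideanSpace.single i (1 : ℝ))).const_add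
      (slice i (0, y))
  exact ((hb.differentiable (by simp)).differentiableAt.hasFDerivAt (x := (slice i (s, y), z))).comp_hasDerivAt s h1

/-! ### Decay from one mixed derivative bounded below -/

/-- The kernel `e^{i lam S(x,z)} b(x,z)`. -/
noncomputable def oscKernel {nX nZ : ℕ} (S : MvPolynomial (Fin nX ⊕ Fin nZ) ℝ) (lam : ℝ)
    (b : EuclideanSpace ℝ (Fin nX) × EuclideanSpace ℝ (Fin nZ) → ℂ)
    (w : EuclideanSpace ℝ (Fin nX) × EuclideanSpace ℝ (Fin nZ)) : ℂ :=
  Complex.exp (Complex.I * ((lam * evalAt S w.1 w.2 : ℝ) : ℂ)) * b w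

theorem continuous_oscKernel {nX nZ : ℕ} (S : MvPolynomial (Fin nX ⊕ Fin nZ) ℝ) (lam : ℝ)
    {b : EuclideanSpace ℝ (Fin nX) × EuclideanSpace ℝ (Fin nZ) → ℂ} (hb : Continuous b) :
    Continuous (oscKernel S lam b) := by
  have := continuous_evalAt S
  unfold oscKernel
  fun_prop

theorem norm_oscKernel {nX nZ : ℕ} (S : MvPolynomial (Fin nX ⊕ Fin nZ) ℝ) (lam : ℝ)
    (b : EuclideanSpace ℝ (Fin nX) × EuclideanSpace ℝ (Fin nZ) → ℂ)
    (w : EuclideanSpace ℝ (Fin nX) × EuclideanSpace ℝ (Fin nZ)) :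
    ‖oscKernel S lam b w‖ = ‖b w‖ := by
  rw [oscKernel, norm_mul, mul_comm Complex.I, Complex.norm_exp_ofReal_mul_I, one_mul]

/-- The mean value theorem in `z_j`, applied to `∂S/∂x_i`, converts the lower bound on the mixed
derivative into the separation `c|t - t'|` of the slices; convexity is needed in `z` only. `C` is
fixed before `b` and `λ`, and this uniformity is what the dyadic sum requires. -/
theorem exists_kernelBound_of_mixed_derivative {p q : ℕ}
    (S : MvPolynomial (Fin (p + 1) ⊕ Fin (q + 1)) ℝ) (i : Fin (p + 1)) (j : Fin (q + 1))
    {U : Set (EuclideanSpace ℝ (Fin (p + 1)))} {V : Set (EuclideanSpace ℝ (Fin (q + 1)))}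
    (hV : Convex ℝ V) {c : ℝ} (hc : 0 < c)
    (hS : ∀ x ∈ U, ∀ z ∈ V, c ≤ |mixedHessian S x z i j|)
    {K : Set (EuclideanSpace ℝ (Fin (p + 1)) × EuclideanSpace ℝ (Fin (q + 1)))}
    (hK : IsCompact K) (hKUV : K ⊆ U ×ˢ V) (M : ℝ) :
    ∃ C, 0 ≤ C ∧ ∀ b : EuclideanSpace ℝ (Fin (p + 1)) × EuclideanSpace ℝ (Fin (q + 1)) → ℂ,
      ContDiff ℝ ∞ b → (∀ w ∉ K, b w = 0) → (∀ w, ‖b w‖ ≤ M) →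
      (∀ w, ‖dirDeriv (EuclideanSpace.single i 1) b w‖ ≤ M) →
      (∀ w, ‖dirDeriv (EuclideanSpace.single i 1)
        (dirDeriv (EuclideanSpace.single i 1) b) w‖ ≤ M) →
      ∀ lam : ℝ, 0 < lam → KernelBound (oscKernel S lam b) (C * lam ^ (-(1 / 2) : ℝ)) := by
  obtain ⟨R, hR0, hR⟩ := hK.isBounded.subset_closedBall_lt 0 0
  set P₁ := MvPolynomial.pderiv (Sum.inl i) S with hP₁
  set P₂ := MvPolynomial.pderiv (Sum.inl i) P₁ with hP₂
  set P₃ := MvPolynomial.pderiv (Sum.inl i) P₂ with hP₃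
  have hbd : ∀ P : MvPolynomial (Fin (p + 1) ⊕ Fin (q + 1)) ℝ, ∃ D, 0 ≤ D ∧
      ∀ x z, ‖x‖ ≤ R → ‖z‖ ≤ R → |evalAt P x z| ≤ D := fun P => by
    obtain ⟨D, hD⟩ := (isCompact_closedBall (0 : EuclideanSpace ℝ (Fin (p + 1)) ×
      EuclideanSpace ℝ (Fin (q + 1))) R).exists_bound_of_continuousOn
        (continuous_evalAt P).continuousOn
    refine ⟨|D|, abs_nonneg D, fun x z hx hz => (hD (x, z) ?_).trans (le_abs_self D)⟩
    simpa [Prod.norm_def] using And.intro hx hz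
  obtain ⟨D₂, hD₂0, hD₂⟩ := hbd (MvPolynomial.pderiv (Sum.inr j) P₂)
  obtain ⟨D₃, hD₃0, hD₃⟩ := hbd (MvPolynomial.pderiv (Sum.inr j) P₃)
  set D := D₂ + D₃ with hD
  set C₀ : ℝ := (2 * R * (4 * M ^ 2 * (1 + 4 * (D / c) + 3 * (D / c) ^ 2)) / c ^ 2
        + 2 * R * M ^ 2 + 1) * Real.pi with hC₀
  have hC₀0 : 0 ≤ C₀ := by positivity
  set vP := (volume (Icc (fun _ => -R) (fun _ => R) : Set (Fin p → ℝ))) with hvP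
  set vQ := (volume (Icc (fun _ => -R) (fun _ => R) : Set (Fin q → ℝ))) with hvQ
  have hvPt : vP ≠ ⊤ := isCompact_Icc.measure_lt_top.ne
  have hvQt : vQ ≠ ⊤ := isCompact_Icc.measure_lt_top.ne
  -- The slice estimates concern squared norms; the two volumes are those of cubes containing the
  -- frozen variables.
  set C := Real.sqrt (vP.toReal * vQ.toReal * C₀) with hC
  refine ⟨C, Real.sqrt_nonneg _, fun b hb hbK hbM hbM₁ hbM₂ lam hlam => ?_⟩
  have hsq : ENNReal.ofReal ((C * lam ^ (-(1 / 2) : ℝ)) ^ 2) =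
      vP * vQ * ENNReal.ofReal (C₀ / lam) := by
    rw [mul_pow, hC, Real.sq_sqrt (by positivity), ← Real.rpow_natCast, ← Real.rpow_mul hlam.le,
      show (-(1 / 2) : ℝ) * ((2 : ℕ) : ℝ) = -1 by norm_num, Real.rpow_neg_one, mul_assoc, ← div_eq_mul_inv,
      ENNReal.ofReal_mul (by positivity), ENNReal.ofReal_mul (by positivity),
      ENNReal.ofReal_toReal hvPt, ENNReal.ofReal_toReal hvQt]
  refine kernelBound_of_sq (by positivity) fun f hf hf2 => ?_
  rw [hsq]
  have hkc : Continuous (oscKernel S lam b) := continuous_oscKernel S lam hb.continuous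
  have hksupp : HasCompactSupport (oscKernel S lam b) :=
    HasCompactSupport.intro hK fun w hw => by simp [oscKernel, hbK w hw]
  have hint := integrable_slice_mul hkc hksupp hf2
  have mX := measurePreserving_slice i
  have mZ := measurePreserving_slice j
  have hinner : ∀ x, ∫ z, oscKernel S lam b (x, z) * f z =
      ∫ z, oscKernel S lam b (x, slice j z) * f (slice j z) := fun x =>
    (mZ.integral_comp' (fun z => oscKernel S lam b (x, z) * f z)).symm
  have hKn : ∀ {x z}, (x, z) ∈ K → ‖x‖ ≤ R ∧ ‖z‖ ≤ R := fun {x z} h => by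
    simpa [Prod.norm_def] using hR h
  simp_rw [hinner]
  rw [← mX.lintegral_comp_emb (slice i).measurableEmbedding
      (fun x => ‖∫ z, oscKernel S lam b (x, slice j z) * f (slice j z)‖ₑ ^ 2),
    ← mZ.lintegral_comp_emb (slice j).measurableEmbedding (fun z => ‖f z‖ₑ ^ 2)]
  refine lintegral_enorm_sq_le_of_slices
    (k := fun x z => oscKernel S lam b (slice i x, slice j z)) ?_
    (P := Icc (fun _ => -R) (fun _ => R)) (Q := Icc (fun _ => -R) (fun _ => R)) measurableSet_Icc
    ?_ ?_ ?_ (hf.comp (slice j).measurable) ?_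
  · exact hkc.measurable.comp (((slice i).measurable.comp measurable_fst).prodMk
      ((slice j).measurable.comp measurable_snd))
  · intro x z hx
    rw [oscKernel, hbK _ fun h => hx (slice_snd_mem_Icc (hKn h).1), mul_zero]
  · intro x z hz
    rw [oscKernel, hbK _ fun h => hz (slice_snd_mem_Icc (hKn h).2), mul_zero]
  · intro x z g hg
    have hcs := continuous_slice i
    have hcs' := continuous_slice j
    have hpair : Continuous fun y : ℝ × ℝ => (slice i (y.1, x), slice j (y.2, z)) := by fun_prop
    have hpair' : ∀ t, Continuous fun s : ℝ => (slice i (s, x), slice j (t, z)) := by fun_prop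
    have hcont : ∀ {F : Type} [TopologicalSpace F] {g : EuclideanSpace ℝ (Fin (p + 1)) ×
        EuclideanSpace ℝ (Fin (q + 1)) → F}, Continuous g → Continuous (Function.uncurry
          fun s t => g (slice i (s, x), slice j (t, z))) := fun hg => hg.comp hpair
    have hcont' : ∀ {F : Type} [TopologicalSpace F] {g : EuclideanSpace ℝ (Fin (p + 1)) ×
        EuclideanSpace ℝ (Fin (q + 1)) → F}, Continuous g → ∀ t, Continuous
          fun s => g (slice i (s, x), slice j (t, z)) := fun hg t => hg.comp (hpair' t)
    have hup : ∀ P : MvPolynomial (Fin (p + 1) ⊕ Fin (q + 1)) ℝ, ∀ D' : ℝ, D' ≤ D →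
        (∀ x z, ‖x‖ ≤ R → ‖z‖ ≤ R → |evalAt (MvPolynomial.pderiv (Sum.inr j) P) x z| ≤ D') →
        ∀ s t t', (slice i (s, x), slice j (t, z)) ∈ K → (slice i (s, x), slice j (t', z)) ∈ K →
        |evalAt P (slice i (s, x)) (slice j (t, z)) - evalAt P (slice i (s, x)) (slice j (t', z))|
          ≤ D * |t - t'| := by
      intro P D' hD' hP s t t' h h'
      obtain ⟨u, hu, e⟩ := exists_sub_eq_mul_of_hasDerivAt
        (hasDerivAt_evalAt_right P j (slice i (s, x)) z) t t'
      rw [e, abs_mul]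
      gcongr
      refine (hP _ _ (hKn h).1 ?_).trans hD'
      have := slice_mem_of_mem_segment (convex_closedBall (0 : EuclideanSpace ℝ (Fin (q + 1))) R)
        (j := j) (y := z) (by simpa using (hKn h).2) (by simpa using (hKn h').2) hu
      simpa using this
    exact lintegral_enorm_sq_oscillatory_le
      (Φ := fun s t => evalAt S (slice i (s, x)) (slice j (t, z)))
      (Φ₁ := fun s t => evalAt P₁ (slice i (s, x)) (slice j (t, z)))
      (Φ₂ := fun s t => evalAt P₂ (slice i (s, x)) (slice j (t, z)))
      (Φ₃ := fun s t => evalAt P₃ (slice i (s, x)) (slice j (t, z)))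
      (β := fun s t => b (slice i (s, x), slice j (t, z)))
      (β₁ := fun s t => dirDeriv (EuclideanSpace.single i 1) b (slice i (s, x), slice j (t, z)))
      (β₂ := fun s t => dirDeriv (EuclideanSpace.single i 1)
        (dirDeriv (EuclideanSpace.single i 1) b) (slice i (s, x), slice j (t, z)))
      (K := (fun y : ℝ × ℝ => (slice i (y.1, x), slice j (y.2, z))) ⁻¹' K)
      (R := R) (c := c) (D := D) (M := M) hR0.le hc (by positivity) hlam
      (hcont (continuous_evalAt S)) (hcont hb.continuous)
      (fun t s => hasDerivAt_evalAt_left S i x _ s)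
      (fun t s => hasDerivAt_evalAt_left P₁ i x _ s)
      (fun t s => hasDerivAt_evalAt_left P₂ i x _ s)
      (fun t => (hcont' (continuous_evalAt P₃) t).measurable)
      (fun t s => hasDerivAt_slice hb i x _ s)
      (fun t s => hasDerivAt_slice (contDiff_dirDeriv _ hb) i x _ s)
      (fun t => (hcont' (contDiff_dirDeriv _ (contDiff_dirDeriv _ hb)).continuous t).measurable)
      (hK.isClosed.preimage hpair)
      (fun y hy => ⟨slice_fst_mem_Icc (hKn hy).1, slice_fst_mem_Icc (hKn hy).2⟩)
      (fun s t h => hbK _ h)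
      (fun s t t' h h' => by
        obtain ⟨u, hu, e⟩ := exists_sub_eq_mul_of_hasDerivAt
          (hasDerivAt_evalAt_right P₁ j (slice i (s, x)) z) t t'
        rw [e, abs_mul]
        gcongr
        have := hS _ (hKUV h).1 _ (slice_mem_of_mem_segment hV (hKUV h).2 (hKUV h').2 hu)
        rwa [mixedHessian, Matrix.of_apply, pderiv_comm] at this)
      (hup P₂ D₂ (by linarith) hD₂) (hup P₃ D₃ (by linarith) hD₃)
      (fun _ _ => hbM _) (fun _ _ => hbM₁ _) (fun _ _ => hbM₂ _) hg
  · intro x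
    exact (mZ.integrable_comp_emb (slice j).measurableEmbedding).2 (hint (slice i x))

/-! ### Sums, bounded kernels and dilations -/

theorem KernelBound.mono {X Z : Type*} [MeasureSpace X] [MeasureSpace Z] {k : X × Z → ℂ}
    {A B : ℝ} (h : KernelBound k A) (hAB : A ≤ B) : KernelBound k B := fun f hf hf2 =>
  (h f hf hf2).trans (by gcongr)

theorem stronglyMeasurable_integral_mul {nX nZ : ℕ} {k : 𝔼 nX × 𝔼 nZ → ℂ} (hk : Continuous k)
    {f : 𝔼 nZ → ℂ} (hf : Measurable f) :
    StronglyMeasurable fun x => ∫ z, k (x, z) * f z :=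
  StronglyMeasurable.integral_prod_right (f := fun x z => k (x, z) * f z)
    (hk.measurable.mul (hf.comp measurable_snd)).stronglyMeasurable

theorem KernelBound.add {nX nZ : ℕ} {k l : 𝔼 nX × 𝔼 nZ → ℂ} {A B : ℝ} (hA : 0 ≤ A) (hB : 0 ≤ B)
    (hk : Continuous k) (hkc : HasCompactSupport k) (hl : Continuous l)
    (hlc : HasCompactSupport l) (h : KernelBound k A) (h' : KernelBound l B) :
    KernelBound (fun w => k w + l w) (A + B) := by
  intro f hf hf2
  have e : (fun x => ∫ z, (k (x, z) + l (x, z)) * f z) =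
      (fun x => ∫ z, k (x, z) * f z) + fun x => ∫ z, l (x, z) * f z := by
    funext x
    simp only [Pi.add_apply, add_mul]
    exact integral_add (integrable_slice_mul hk hkc hf2 x) (integrable_slice_mul hl hlc hf2 x)
  rw [e, ENNReal.ofReal_add hA hB, add_mul]
  exact (eLpNorm_add_le (stronglyMeasurable_integral_mul hk hf).aestronglyMeasurable
    (stronglyMeasurable_integral_mul hl hf).aestronglyMeasurable (by norm_num)).trans
    (add_le_add (h f hf hf2) (h' f hf hf2))

theorem kernelBound_zero {X Z : Type*} [MeasureSpace X] [MeasureSpace Z] :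
    KernelBound (fun _ : X × Z => 0) 0 := fun f _ _ => by simp

theorem KernelBound.sum {nX nZ : ℕ} {ι : Type*} (s : Finset ι) {k : ι → 𝔼 nX × 𝔼 nZ → ℂ}
    {A : ι → ℝ} (hA : ∀ i ∈ s, 0 ≤ A i) (hk : ∀ i ∈ s, Continuous (k i))
    (hkc : ∀ i ∈ s, HasCompactSupport (k i)) (h : ∀ i ∈ s, KernelBound (k i) (A i)) :
    KernelBound (fun w => ∑ i ∈ s, k i w) (∑ i ∈ s, A i) := by
  classical
  -- The induction also carries continuity and compact support of the partial sums, which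
  -- `KernelBound.add` requires.
  suffices H : Continuous (fun w => ∑ i ∈ s, k i w) ∧ HasCompactSupport (fun w => ∑ i ∈ s, k i w) ∧
      KernelBound (fun w => ∑ i ∈ s, k i w) (∑ i ∈ s, A i) from H.2.2
  induction s using Finset.induction_on with
  | empty =>
    simp only [Finset.sum_empty]
    exact ⟨continuous_const, HasCompactSupport.intro isCompact_empty fun _ _ => rfl,
      kernelBound_zero⟩
  | insert a s ha ih =>
    simp only [Finset.forall_mem_insert] at hA hk hkc h
    obtain ⟨h1, h2, h3⟩ := ih hA.2 hk.2 hkc.2 h.2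
    simp only [Finset.sum_insert ha]
    exact ⟨hk.1.add h1, hkc.1.add h2,
      KernelBound.add hA.1 (Finset.sum_nonneg hA.2) hk.1 hkc.1 h1 h2 h.1 h3⟩

/-- Cauchy–Schwarz in `z`, with no use of oscillation. It serves for the piece around the origin,
uniformly in `λ` since the exponential has modulus 1. -/
theorem exists_kernelBound_of_bounded (nX nZ : ℕ) (R : ℝ) {M : ℝ} (hM : 0 ≤ M) :
    ∃ C, 0 ≤ C ∧ ∀ k : 𝔼 nX × 𝔼 nZ → ℂ, (∀ w ∉ Metric.closedBall 0 R, k w = 0) →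
      (∀ w, ‖k w‖ ≤ M) → KernelBound k C := by
  set vX := volume (Metric.closedBall (0 : 𝔼 nX) R) with hvX
  set vZ := volume (Metric.closedBall (0 : 𝔼 nZ) R) with hvZ
  have hvXt : vX ≠ ⊤ := (isCompact_closedBall _ _).measure_lt_top.ne
  have hvZt : vZ ≠ ⊤ := (isCompact_closedBall _ _).measure_lt_top.ne
  refine ⟨M * Real.sqrt (vX.toReal * vZ.toReal), by positivity, fun k hk hkM => ?_⟩
  refine kernelBound_of_sq (by positivity) fun f hf hf2 => ?_
  have h0 : ∀ x z, (x ∉ Metric.closedBall (0 : 𝔼 nX) R ∨ z ∉ Metric.closedBall (0 : 𝔼 nZ) R) →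
      k (x, z) = 0 := fun x z h => hk _ fun h' => by
    rw [show (0 : 𝔼 nX × 𝔼 nZ) = (0, 0) from rfl, ← closedBall_prod_same] at h'
    exact h.elim (fun h => h h'.1) fun h => h h'.2
  have hpt : ∀ x, ‖∫ z, k (x, z) * f z‖ₑ ^ 2 ≤ (Metric.closedBall (0 : 𝔼 nX) R).indicator
      (fun _ => ENNReal.ofReal (M ^ 2) * (vZ * ∫⁻ z, ‖f z‖ₑ ^ 2)) x := by
    intro x
    by_cases hx : x ∈ Metric.closedBall (0 : 𝔼 nX) R
    · rw [indicator_of_mem hx]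
      have e : ∫ z, k (x, z) * f z = ∫ z in Metric.closedBall 0 R, k (x, z) * f z :=
        (setIntegral_eq_integral_of_forall_compl_eq_zero fun z hz => by
          rw [h0 x z (Or.inr hz), zero_mul]).symm
      have b : ‖∫ z, k (x, z) * f z‖ₑ ≤
          ENNReal.ofReal M * ∫⁻ z in Metric.closedBall 0 R, ‖f z‖ₑ := by
        rw [e, ← lintegral_const_mul _ hf.enorm]
        refine (enorm_integral_le_lintegral_enorm _).trans (lintegral_mono fun z => ?_)
        rw [enorm_mul]
        gcongr
        rw [← ofReal_norm]
        exact ENNReal.ofReal_le_ofReal (hkM _)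
      calc ‖∫ z, k (x, z) * f z‖ₑ ^ 2
          ≤ (ENNReal.ofReal M * ∫⁻ z in Metric.closedBall 0 R, ‖f z‖ₑ) ^ 2 := by gcongr
        _ ≤ ENNReal.ofReal (M ^ 2) * (vZ * ∫⁻ z in Metric.closedBall 0 R, ‖f z‖ₑ ^ 2) := by
          rw [mul_pow, ENNReal.ofReal_pow hM]
          gcongr
          refine (sq_lintegral_le _ hf.enorm).trans (le_of_eq ?_)
          rw [Measure.restrict_apply_univ]
        _ ≤ _ := by
          gcongr
          exact Measure.restrict_le_self
    · rw [indicator_of_notMem hx]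
      simp [h0 x _ (Or.inl hx)]
  refine (lintegral_mono hpt).trans (le_of_eq ?_)
  rw [lintegral_indicator_const Metric.isClosed_closedBall.measurableSet, mul_pow,
    Real.sq_sqrt (by positivity), ENNReal.ofReal_mul (by positivity),
    ENNReal.ofReal_mul (by positivity), ENNReal.ofReal_toReal hvXt, ENNReal.ofReal_toReal hvZt]
  ring

theorem lintegral_comp_smul_euclidean {n : ℕ} {F : 𝔼 n → ENNReal} (hF : Measurable F) {r : ℝ}
    (hr : 0 < r) : ∫⁻ x, F (r • x) = ENNReal.ofReal ((r ^ n)⁻¹) * ∫⁻ x, F x := by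
  rw [← lintegral_map hF (measurable_const_smul r), Measure.map_addHaar_smul _ hr.ne',
    lintegral_smul_measure, finrank_euclideanSpace_fin, abs_of_pos (by positivity), smul_eq_mul]

/-- Dilating a kernel. -/
theorem KernelBound.comp_smul {nX nZ : ℕ} {k : 𝔼 nX × 𝔼 nZ → ℂ} (hkc : Continuous k) {A : ℝ}
    (hA : 0 ≤ A) (h : KernelBound k A) {r : ℝ} (hr : 0 < r) :
    KernelBound (fun w => k (r • w)) (A * r ^ (-(((nX : ℝ) + nZ) / 2))) := by
  refine kernelBound_of_sq (by positivity) fun f hf hf2 => ?_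
  set g : 𝔼 nZ → ℂ := fun z => f (r⁻¹ • z) with hg
  have hgm : Measurable g := hf.comp (measurable_const_smul _)
  have hgn : ∫⁻ z, ‖g z‖ₑ ^ 2 = ENNReal.ofReal (r ^ nZ) * ∫⁻ z, ‖f z‖ₑ ^ 2 := by
    rw [hg, lintegral_comp_smul_euclidean (F := fun z => ‖f z‖ₑ ^ 2) (hf.enorm.pow_const 2)
      (inv_pos.2 hr), inv_pow, inv_inv]
  have hg2 : MemLp g 2 := by
    refine ⟨hgm.aestronglyMeasurable, ?_⟩
    have : eLpNorm g 2 ^ 2 < ⊤ := by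
      rw [eLpNorm_two_sq, hgn, ← eLpNorm_two_sq]
      exact ENNReal.mul_lt_top (by simp) (ENNReal.pow_lt_top hf2.2)
    exact (ENNReal.pow_lt_top_iff.1 this).resolve_right (by norm_num)
  have h1 := h g hgm hg2
  have h2 : ∫⁻ x, ‖∫ z, k (x, z) * g z‖ₑ ^ 2 ≤ ENNReal.ofReal (A ^ 2) * ∫⁻ z, ‖g z‖ₑ ^ 2 := by
    rw [← eLpNorm_two_sq, ← eLpNorm_two_sq, ENNReal.ofReal_pow hA, ← mul_pow]
    gcongr
  have h3 : ∀ x, ∫ z, k (r • (x, z)) * f z =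
      ((r ^ nZ)⁻¹ : ℝ) • ∫ z, k (r • x, z) * g z := fun x => by
    have := Measure.integral_comp_smul (volume : Measure (𝔼 nZ)) (fun z => k (r • x, z) * g z) r
    rw [finrank_euclideanSpace_fin, abs_of_pos (by positivity)] at this
    rw [← this]
    simp [hg, smul_smul, inv_mul_cancel₀ hr.ne']
  have hm : Measurable fun x => ‖∫ z, k (x, z) * g z‖ₑ ^ 2 :=
    (stronglyMeasurable_integral_mul hkc hgm).measurable.enorm.pow_const 2
  have h4 : ∫⁻ x, ‖∫ z, k (r • (x, z)) * f z‖ₑ ^ 2 =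
      ENNReal.ofReal (((r ^ nZ)⁻¹) ^ 2) *
        (ENNReal.ofReal ((r ^ nX)⁻¹) * ∫⁻ x, ‖∫ z, k (x, z) * g z‖ₑ ^ 2) := by
    simp_rw [h3, enorm_smul, mul_pow]
    rw [lintegral_const_mul' _ _ (by simp),
      lintegral_comp_smul_euclidean (F := fun x => ‖∫ z, k (x, z) * g z‖ₑ ^ 2) hm hr,
      Real.enorm_of_nonneg (by positivity), ENNReal.ofReal_pow (by positivity)]
  rw [h4]
  -- In the squared norm the substitution in `z` gives `r^(-2nZ)`, the one in `x` gives `r^(-nX)`,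
  -- and `‖g‖²` gives back `r^nZ`: in all `r^(-(nX+nZ))`.
  calc _ ≤ ENNReal.ofReal (((r ^ nZ)⁻¹) ^ 2) * (ENNReal.ofReal ((r ^ nX)⁻¹) *
        (ENNReal.ofReal (A ^ 2) * (ENNReal.ofReal (r ^ nZ) * ∫⁻ z, ‖f z‖ₑ ^ 2))) := by
        rw [← hgn]
        gcongr
    _ = _ := by
      simp only [← mul_assoc]
      congr 1
      rw [← ENNReal.ofReal_mul (by positivity), ← ENNReal.ofReal_mul (by positivity),
        ← ENNReal.ofReal_mul (by positivity)]
      congr 1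
      rw [mul_pow, ← Real.rpow_natCast (r ^ _) 2, ← Real.rpow_mul hr.le,
        show -(((nX : ℝ) + nZ) / 2) * ((2 : ℕ) : ℝ) = -((nX + nZ : ℕ) : ℝ) by push_cast; ring,
        Real.rpow_neg hr.le, Real.rpow_natCast, pow_add]
      field_simp

/-! ### Uniform bounds for amplitude families supported away from the origin -/

theorem dirDeriv_eq_zero {X Z : Type*} [NormedAddCommGroup X] [NormedSpace ℝ X]
    [NormedAddCommGroup Z] [NormedSpace ℝ Z] (v : X) {b : X × Z → ℂ} {K : Set (X × Z)}
    (hK : IsClosed K) (hb : ∀ w ∉ K, b w = 0) {w : X × Z} (hw : w ∉ K) : dirDeriv v b w = 0 := by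
  have : b =ᶠ[𝓝 w] fun _ => 0 := by
    filter_upwards [hK.isOpen_compl.mem_nhds hw] with u hu using hb u hu
  rw [dirDeriv, this.fderiv_eq]
  simp

/-- The derivative of a smooth family is again a smooth family in the same parameter, so the step
can be iterated. -/
theorem exists_contDiff_dirDeriv {X Z : Type*} [NormedAddCommGroup X] [NormedSpace ℝ X]
    [NormedAddCommGroup Z] [NormedSpace ℝ Z] (v : X) {F : ℝ × (X × Z) → ℂ}
    (hF : ContDiff ℝ ∞ F) : ∃ G : ℝ × (X × Z) → ℂ, ContDiff ℝ ∞ G ∧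
      ∀ δ, dirDeriv v (fun w => F (δ, w)) = fun w => G (δ, w) := by
  refine ⟨fun p => fderiv ℝ F p (0, (v, 0)),
    (hF.fderiv_right (m := ∞) (by simp)).clm_apply contDiff_const, fun δ => funext fun w => ?_⟩
  have h := ((hF.differentiable (by simp)).differentiableAt.hasFDerivAt (x := (δ, w))).comp w
    (hasFDerivAt_prodMk_right δ w)
  rw [dirDeriv]
  have h' : HasFDerivAt (fun w => F (δ, w)) _ w := h
  rw [h'.fderiv]
  simp

/-- Compactness of `[0, 1] × K`. Including `δ = 0` makes the bound uniform along `δ = 2^(-j)`. -/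
theorem exists_bound_of_contDiff {X Z : Type*} [NormedAddCommGroup X] [NormedSpace ℝ X]
    [NormedAddCommGroup Z] [NormedSpace ℝ Z] {F : ℝ × (X × Z) → ℂ}
    (hF : Continuous F) {K : Set (X × Z)} (hK : IsCompact K) (hFK : ∀ δ, ∀ w ∉ K, F (δ, w) = 0) :
    ∃ M, 0 ≤ M ∧ ∀ δ ∈ Icc (0 : ℝ) 1, ∀ w, ‖F (δ, w)‖ ≤ M := by
  obtain ⟨M, hM⟩ := (isCompact_Icc.prod hK : IsCompact (Icc (0 : ℝ) 1 ×ˢ K)).exists_bound_of_continuousOn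
    hF.continuousOn
  refine ⟨|M|, abs_nonneg _, fun δ hδ w => ?_⟩
  by_cases hw : w ∈ K
  · exact (hM (δ, w) ⟨hδ, hw⟩).trans (le_abs_self M)
  · rw [hFK δ w hw, norm_zero]
    exact abs_nonneg _

/-- By continuity a nonzero entry of the mixed Hessian keeps half its size on a ball, which in the
product norm is a product of convex balls. The radius is chosen before `K` and `F`, so that a
partition of unity can be fitted to it. -/
theorem exists_kernelBound_near {nX nZ : ℕ} {S : MvPolynomial (Fin nX ⊕ Fin nZ) ℝ}
    (hS : RankOneCondition S) {w₀ : 𝔼 nX × 𝔼 nZ} (hw₀ : w₀ ≠ 0) :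
    ∃ r, 0 < r ∧ ∀ K : Set (𝔼 nX × 𝔼 nZ), IsCompact K → K ⊆ Metric.ball w₀ r →
      ∀ F : ℝ × (𝔼 nX × 𝔼 nZ) → ℂ, ContDiff ℝ ∞ F → (∀ δ, ∀ w ∉ K, F (δ, w) = 0) →
      ∃ C, 0 ≤ C ∧ ∀ δ ∈ Icc (0 : ℝ) 1, ∀ lam : ℝ, 0 < lam →
        KernelBound (oscKernel S lam fun w => F (δ, w)) (C * lam ^ (-(1 / 2) : ℝ)) := by
  obtain ⟨i, j, hij⟩ : ∃ i j, mixedHessian S w₀.1 w₀.2 i j ≠ 0 := by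
    by_contra! h
    have h0 : mixedHessian S w₀.1 w₀.2 = 0 := Matrix.ext h
    have := hS w₀.1 w₀.2 hw₀
    rw [h0, Matrix.rank_zero] at this
    omega
  -- The indices `i` and `j` of the entry force both dimensions to be positive, as `slice` needs.
  obtain ⟨p, rfl⟩ := Nat.exists_eq_succ_of_ne_zero i.pos.ne'
  obtain ⟨q, rfl⟩ := Nat.exists_eq_succ_of_ne_zero j.pos.ne'
  have hcont : Continuous fun w : 𝔼 (p + 1) × 𝔼 (q + 1) => |mixedHessian S w.1 w.2 i j| :=
    (continuous_evalAt _).abs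
  have hpos : 0 < |mixedHessian S w₀.1 w₀.2 i j| := abs_pos.2 hij
  obtain ⟨r, hr, hball⟩ := Metric.eventually_nhds_iff_ball.1
    (hcont.continuousAt.eventually (lt_mem_nhds (half_lt_self hpos)))
  refine ⟨r, hr, fun K hK hKr F hF hFK => ?_⟩
  set v : 𝔼 (p + 1) := EuclideanSpace.single i 1 with hv
  obtain ⟨G, hG, hFG⟩ := exists_contDiff_dirDeriv v hF
  obtain ⟨H, hH, hGH⟩ := exists_contDiff_dirDeriv v hG
  have hGK : ∀ δ, ∀ w ∉ K, G (δ, w) = 0 := fun δ w hw => by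
    have := dirDeriv_eq_zero v hK.isClosed (hFK δ) hw
    rwa [hFG] at this
  have hHK : ∀ δ, ∀ w ∉ K, H (δ, w) = 0 := fun δ w hw => by
    have := dirDeriv_eq_zero v hK.isClosed (hGK δ) hw
    rwa [hGH] at this
  obtain ⟨M₀, hM₀, hb₀⟩ := exists_bound_of_contDiff hF.continuous hK hFK
  obtain ⟨M₁, hM₁, hb₁⟩ := exists_bound_of_contDiff hG.continuous hK hGK
  obtain ⟨M₂, hM₂, hb₂⟩ := exists_bound_of_contDiff hH.continuous hK hHK
  obtain ⟨C, hC0, hC⟩ := exists_kernelBound_of_mixed_derivative S i j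
    (U := Metric.ball w₀.1 r) (V := Metric.ball w₀.2 r) (convex_ball _ _) (half_pos hpos)
    (fun x hx z hz => (hball (x, z) (by
      rw [← Prod.mk.eta (p := w₀), ← ball_prod_same]; exact ⟨hx, hz⟩)).le) hK
    (by rw [ball_prod_same]; exact hKr) (M₀ + M₁ + M₂)
  refine ⟨C, hC0, fun δ hδ lam hlam => hC _ ?_ (hFK δ) ?_ ?_ ?_ lam hlam⟩
  · exact hF.comp (contDiff_const.prodMk contDiff_id)
  · exact fun w => (hb₀ δ hδ w).trans (by linarith)
  · intro w
    rw [hFG]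
    exact (hb₁ δ hδ w).trans (by linarith)
  · intro w
    rw [hFG, hGH]
    exact (hb₂ δ hδ w).trans (by linarith)

-- Finitely many good balls cover `K`; a smooth partition of unity splits the amplitude among them
-- and the constants add.
open scoped Manifold in
theorem exists_kernelBound_away_from_zero {nX nZ : ℕ} {S : MvPolynomial (Fin nX ⊕ Fin nZ) ℝ}
    (hS : RankOneCondition S) {K : Set (𝔼 nX × 𝔼 nZ)} (hK : IsCompact K) (hK0 : 0 ∉ K)
    {F : ℝ × (𝔼 nX × 𝔼 nZ) → ℂ} (hF : ContDiff ℝ ∞ F) (hFK : ∀ δ, ∀ w ∉ K, F (δ, w) = 0) :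
    ∃ C, 0 ≤ C ∧ ∀ δ ∈ Icc (0 : ℝ) 1, ∀ lam : ℝ, 0 < lam →
      KernelBound (oscKernel S lam fun w => F (δ, w)) (C * lam ^ (-(1 / 2) : ℝ)) := by
  have hnear := fun (w : 𝔼 nX × 𝔼 nZ) (hw : w ≠ 0) => exists_kernelBound_near hS hw
  choose! r hr hrK using hnear
  have hne : ∀ w ∈ K, w ≠ 0 := fun w hw h => hK0 (h ▸ hw)
  obtain ⟨t, htK, ht⟩ := hK.elim_nhds_subcover (fun w => Metric.ball w (r w))
    fun w hw => Metric.ball_mem_nhds w (hr w (hne w hw))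
  obtain ⟨ρ, hρ⟩ := SmoothPartitionOfUnity.exists_isSubordinate 𝓘(ℝ, 𝔼 nX × 𝔼 nZ) hK.isClosed
    (fun w : t => Metric.ball (w : 𝔼 nX × 𝔼 nZ) (r w)) (fun _ => Metric.isOpen_ball)
    (fun w hw => by
      obtain ⟨u, hu, huw⟩ := mem_iUnion₂.1 (ht hw)
      exact mem_iUnion.2 ⟨⟨u, hu⟩, huw⟩)
  have hρs : ∀ i, ContDiff ℝ ∞ (ρ i) := fun i => (ρ i).contMDiff.contDiff
  have hlocal : ∀ i : t, ∃ C, 0 ≤ C ∧ ∀ δ ∈ Icc (0 : ℝ) 1, ∀ lam : ℝ, 0 < lam →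
      KernelBound (oscKernel S lam fun w => (ρ i w : ℂ) * F (δ, w))
        (C * lam ^ (-(1 / 2) : ℝ)) := by
    intro i
    refine hrK i (hne _ (htK _ i.2)) (K ∩ tsupport (ρ i)) (hK.inter_right (isClosed_tsupport _))
      (inter_subset_right.trans (hρ i)) (fun p => (ρ i p.2 : ℂ) * F p) ?_ ?_
    · exact (Complex.ofRealCLM.contDiff.comp ((hρs i).comp contDiff_snd)).mul hF
    · intro δ w hw
      by_cases h : w ∈ K
      · have : ρ i w = 0 := by
          by_contra h'
          exact hw ⟨h, subset_tsupport _ h'⟩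
        simp [this]
      · simp [hFK δ w h]
  choose C hC0 hC using hlocal
  refine ⟨∑ i, C i, Finset.sum_nonneg fun i _ => hC0 i, fun δ hδ lam hlam => ?_⟩
  have hFδ : Continuous fun w => F (δ, w) := hF.continuous.comp (by fun_prop)
  have hsum : oscKernel S lam (fun w => F (δ, w)) =
      fun w => ∑ i, oscKernel S lam (fun w => (ρ i w : ℂ) * F (δ, w)) w := by
    funext w
    simp only [oscKernel]
    rw [← Finset.mul_sum, ← Finset.sum_mul]
    by_cases hw : w ∈ K
    · have := ρ.sum_eq_one hw
      rw [finsum_eq_sum_of_fintype] at this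
      rw [← Complex.ofReal_sum, this, Complex.ofReal_one, one_mul]
    · rw [hFK δ w hw, mul_zero, mul_zero, mul_zero]
  rw [hsum, Finset.sum_mul]
  refine KernelBound.sum _ (fun i _ => mul_nonneg (hC0 i) (by positivity)) (fun i _ => ?_)
    (fun i _ => ?_) fun i _ => hC i δ hδ lam hlam
  · have := (hρs i).continuous
    exact continuous_oscKernel S lam (by fun_prop)
  · exact HasCompactSupport.intro hK fun w hw => by simp [oscKernel, hFK δ w hw]

/-! ### Dyadic decomposition at the origin -/

theorem evalAt_smul {nX nZ m : ℕ} {S : MvPolynomial (Fin nX ⊕ Fin nZ) ℝ} (hS : S.IsHomogeneous m)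
    (r : ℝ) (x : 𝔼 nX) (z : 𝔼 nZ) : evalAt S (r • x) (r • z) = r ^ m * evalAt S x z := by
  have hv : (Sum.elim (fun i => (r • x) i) fun j => (r • z) j) =
      fun l => r * Sum.elim (fun i => x i) (fun j => z j) l := by
    funext l
    rcases l with l | l <;> simp
  rw [evalAt, evalAt, hv, MvPolynomial.eval_eq', MvPolynomial.eval_eq', Finset.mul_sum]
  refine Finset.sum_congr rfl fun d hd => ?_
  have hdeg : ∑ l, d l = m := by
    have := hS (MvPolynomial.mem_support_iff.1 hd)
    rw [← this, Finsupp.weight_apply, Finsupp.sum_fintype _ _ (by simp)]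
    simp
  simp_rw [mul_pow]
  rw [Finset.prod_mul_distrib, Finset.prod_pow_eq_pow_sum, hdeg]
  ring

/-- The dyadic decomposition of `e^{i lam S} a` around the origin. -/
theorem exists_kernelBound_dyadic {nX nZ m : ℕ} {S : MvPolynomial (Fin nX ⊕ Fin nZ) ℝ}
    (hS : S.IsHomogeneous m) (hrank : RankOneCondition S) {a : 𝔼 nX × 𝔼 nZ → ℂ}
    (ha : ContDiff ℝ ∞ a) (hsupp : HasCompactSupport a) :
    ∃ C, 0 ≤ C ∧ ∀ lam : ℝ, 0 < lam → ∀ J : ℕ, KernelBound (oscKernel S lam a)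
      (C * (lam ^ (-(1 / 2) : ℝ) *
        ∑ j ∈ Finset.range J, ((2 : ℝ) ^ (((m : ℝ) - (nX + nZ)) / 2)) ^ j) +
        C * ((2 : ℝ) ^ J) ^ (-(((nX : ℝ) + nZ) / 2))) := by
  obtain ⟨R, hR0, hR⟩ := hsupp.isCompact.isBounded.subset_closedBall_lt 0 0
  -- `θ` is 1 on the support of `a`, and `θ(w) - θ(2w)` lives on the shell `R/2 ≤ |w| ≤ 2R`.
  let θ : ContDiffBump (0 : 𝔼 nX × 𝔼 nZ) := ⟨R, 2 * R, hR0, by linarith⟩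
  have hθ1 : ∀ w, ‖w‖ ≤ R → θ w = 1 := fun w hw => θ.one_of_mem_closedBall (by simpa using hw)
  have hθ0 : ∀ w, 2 * R ≤ ‖w‖ → θ w = 0 := fun w hw => θ.zero_of_le_dist (by simpa using hw)
  have hθs : ContDiff ℝ ∞ θ := θ.contDiff
  set K : Set (𝔼 nX × 𝔼 nZ) := Metric.closedBall 0 (2 * R) \ Metric.ball 0 (R / 2) with hK
  have hKc : IsCompact K := (isCompact_closedBall _ _).diff Metric.isOpen_ball
  -- At `δ = 2^(-j)` this is the amplitude of shell `j` after dilation by `2^j`. It is smooth in `δ`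
  -- through 0, so one constant serves all `j`.
  set F : ℝ × (𝔼 nX × 𝔼 nZ) → ℂ := fun p =>
    a (p.1 • p.2) * ((θ p.2 - θ ((2 : ℝ) • p.2) : ℝ) : ℂ) with hFdef
  have hF : ContDiff ℝ ∞ F := by
    refine (ha.comp (contDiff_fst.smul contDiff_snd)).mul (Complex.ofRealCLM.contDiff.comp ?_)
    exact (hθs.comp contDiff_snd).sub (hθs.comp (contDiff_snd.const_smul (2 : ℝ)))
  have hFK : ∀ δ, ∀ w ∉ K, F (δ, w) = 0 := by
    intro δ w hw
    have hn : ‖(2 : ℝ) • w‖ = 2 * ‖w‖ := by rw [norm_smul]; simp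
    suffices θ w - θ ((2 : ℝ) • w) = 0 by simp only [hFdef, this, Complex.ofReal_zero, mul_zero]
    by_cases h : ‖w‖ ≤ 2 * R
    · have h' : ‖w‖ < R / 2 := by
        by_contra h''
        exact hw ⟨by simpa using h, by simpa using h''⟩
      rw [hθ1 w (by linarith), hθ1 _ (by linarith), sub_self]
    · rw [hθ0 w (by linarith), hθ0 _ (by linarith), sub_self]
  obtain ⟨C₁, hC₁0, hC₁⟩ := exists_kernelBound_away_from_zero hrank hKc
    (by simp [hK, hR0]) hF hFK
  obtain ⟨M, hM⟩ := hsupp.exists_bound_of_continuous ha.continuous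
  have hM0 : 0 ≤ M := (norm_nonneg _).trans (hM 0)
  obtain ⟨C₂, hC₂0, hC₂⟩ := exists_kernelBound_of_bounded nX nZ (2 * R) hM0
  refine ⟨C₁ + C₂, by positivity, fun lam hlam J => ?_⟩
  have hscale : ∀ (b : 𝔼 nX × 𝔼 nZ → ℂ) (j : ℕ) w,
      oscKernel S (lam * ((2 ^ j : ℝ) ^ m)⁻¹) b ((2 ^ j : ℝ) • w) =
        oscKernel S lam (fun w => b ((2 ^ j : ℝ) • w)) w := by
    intro b j w
    simp only [oscKernel, Prod.smul_fst, Prod.smul_snd]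
    rw [evalAt_smul hS, ← mul_assoc, mul_assoc lam, inv_mul_cancel₀ (by positivity), mul_one]
  have h2j : ∀ j : ℕ, ((2 : ℝ) ^ j)⁻¹ ∈ Icc (0 : ℝ) 1 := fun j =>
    ⟨by positivity, inv_le_one_of_one_le₀ (one_le_pow₀ (by norm_num))⟩
  set k : ℕ → 𝔼 nX × 𝔼 nZ → ℂ := fun j w =>
    oscKernel S (lam * ((2 ^ j : ℝ) ^ m)⁻¹) (fun w => F (((2 : ℝ) ^ j)⁻¹, w)) ((2 ^ j : ℝ) • w)
    with hk
  set l : 𝔼 nX × 𝔼 nZ → ℂ := fun w => oscKernel S (lam * ((2 ^ J : ℝ) ^ m)⁻¹)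
    (fun w => a (((2 : ℝ) ^ J)⁻¹ • w) * (θ w : ℂ)) ((2 ^ J : ℝ) • w) with hl
  have hcancel : ∀ (j : ℕ) (w : 𝔼 nX × 𝔼 nZ), ((2 : ℝ) ^ j)⁻¹ • ((2 : ℝ) ^ j) • w = w :=
    fun j w => by rw [smul_smul, inv_mul_cancel₀ (by positivity), one_smul]
  -- The cutoffs telescope to `θ`, which may be dropped because it is 1 wherever `a ≠ 0`.
  have hdec : oscKernel S lam a = fun w => (∑ j ∈ Finset.range J, k j w) + l w := by
    funext w
    simp only [hk, hl, hscale, hFdef, hcancel]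
    simp only [oscKernel]
    rw [← Finset.mul_sum, ← Finset.mul_sum, ← mul_add, ← mul_add, ← Complex.ofReal_sum,
      ← Complex.ofReal_add]
    have htel : ∑ j ∈ Finset.range J, (θ ((2 : ℝ) ^ j • w) - θ ((2 : ℝ) • (2 : ℝ) ^ j • w)) =
        θ w - θ ((2 : ℝ) ^ J • w) := by
      have := Finset.sum_range_sub' (fun j => θ ((2 : ℝ) ^ j • w)) J
      simpa only [pow_zero, one_smul, smul_smul, ← pow_succ'] using this
    rw [htel, sub_add_cancel]
    by_cases hw : a w = 0
    · rw [hw, zero_mul]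
    · rw [hθ1 w (by simpa using hR (subset_tsupport _ hw)), Complex.ofReal_one, mul_one]
  have hcs : ∀ (b : 𝔼 nX × 𝔼 nZ → ℂ) (mu : ℝ) (j : ℕ), HasCompactSupport b →
      HasCompactSupport fun w => oscKernel S mu b ((2 ^ j : ℝ) • w) := by
    intro b mu j hb
    have : HasCompactSupport (oscKernel S mu b) := hb.mul_left
    exact this.comp_smul (by positivity)
  have hFcont : ∀ δ, Continuous fun w => F (δ, w) := fun δ => hF.continuous.comp (by fun_prop)
  have hFcs : ∀ δ, HasCompactSupport fun w => F (δ, w) := fun δ =>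
    HasCompactSupport.intro hKc (hFK δ)
  -- `(λ2^(-jm))^(-1/2)` from the fixed shell times `2^(-j(nX+nZ)/2)` from the dilation.
  have hpiece : ∀ j, KernelBound (k j) (C₁ * lam ^ (-(1 / 2) : ℝ) *
      ((2 : ℝ) ^ (((m : ℝ) - (nX + nZ)) / 2)) ^ j) := by
    intro j
    have h1 := KernelBound.comp_smul (continuous_oscKernel S _ (hFcont _)) (by positivity)
      (hC₁ _ (h2j j) (lam * ((2 ^ j : ℝ) ^ m)⁻¹) (by positivity)) (r := (2 : ℝ) ^ j) (by positivity)
    refine h1.mono (le_of_eq ?_)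
    rw [Real.mul_rpow hlam.le (by positivity), mul_assoc C₁, mul_assoc (lam ^ _), mul_assoc C₁]
    congr 2
    rw [← Real.rpow_natCast 2 j, ← Real.rpow_natCast _ m, ← Real.rpow_mul (by norm_num),
      ← Real.rpow_neg (by norm_num), ← Real.rpow_mul (by norm_num), ← Real.rpow_mul (by norm_num),
      ← Real.rpow_natCast _ j, ← Real.rpow_mul (by norm_num), ← Real.rpow_add (by norm_num)]
    congr 1
    ring
  have hbcont : Continuous fun w => a (((2 : ℝ) ^ J)⁻¹ • w) * (θ w : ℂ) :=
    (ha.continuous.comp (continuous_const_smul _)).mul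
      (Complex.continuous_ofReal.comp hθs.continuous)
  have hrest : KernelBound l (C₂ * ((2 : ℝ) ^ J) ^ (-(((nX : ℝ) + nZ) / 2))) := by
    refine KernelBound.comp_smul (continuous_oscKernel S _ hbcont) hC₂0 (hC₂ _ ?_ ?_)
      (by positivity)
    · intro w hw
      have hw' : 2 * R ≤ ‖w‖ := by
        simp only [Metric.mem_closedBall, dist_zero_right, not_le] at hw
        exact hw.le
      simp [oscKernel, hθ0 w hw']
    · intro w
      rw [norm_oscKernel, norm_mul, Complex.norm_real, Real.norm_of_nonneg θ.nonneg]
      exact (mul_le_mul (hM _) θ.le_one θ.nonneg hM0).trans (by rw [mul_one])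
  rw [hdec]
  have hsc : ∀ j : ℕ, Continuous fun w : 𝔼 nX × 𝔼 nZ => (2 ^ j : ℝ) • w := fun j =>
    continuous_const_smul _
  have hkcont : ∀ j, Continuous (k j) := fun j =>
    (continuous_oscKernel S _ (hFcont _)).comp (hsc j)
  have hkcs : ∀ j, HasCompactSupport (k j) := fun j => hcs _ _ j (hFcs _)
  have hlcs : HasCompactSupport l := by
    refine hcs _ _ J ?_
    exact HasCompactSupport.mul_left (HasCompactSupport.intro
      (isCompact_closedBall (0 : 𝔼 nX × 𝔼 nZ) (2 * R)) fun w hw => by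
        simp only [Metric.mem_closedBall, dist_zero_right, not_le] at hw
        rw [hθ0 w hw.le, Complex.ofReal_zero])
  refine (KernelBound.add (Finset.sum_nonneg fun j _ => by positivity) (by positivity)
    (continuous_finsetSum _ fun j _ => hkcont j) ?_
    ((continuous_oscKernel S _ hbcont).comp (hsc J)) hlcs
    (KernelBound.sum (Finset.range J) (fun j _ => by positivity) (fun j _ => hkcont j)
      (fun j _ => hkcs j) fun j _ => hpiece j) hrest).mono ?_
  · refine HasCompactSupport.intro (K := ⋃ j ∈ Finset.range J, tsupport (k j))
      (Finset.isCompact_biUnion _ fun j _ => (hkcs j).isCompact) fun w hw => ?_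
    refine Finset.sum_eq_zero fun j hj => ?_
    by_contra h
    exact hw (mem_biUnion hj (subset_tsupport _ h))
  · rw [← Finset.mul_sum, mul_assoc]
    gcongr <;> linarith

/-! ### The operator on `L²` and the summation over shells -/

/-- A bounded kernel operator on `L²` as a continuous linear map. -/
theorem KernelBound.exists_clm {nX nZ : ℕ} {k : 𝔼 nX × 𝔼 nZ → ℂ} (hk : Continuous k)
    (hkc : HasCompactSupport k) {A : ℝ} (hA : 0 ≤ A) (h : KernelBound k A) :
    ∃ T : Lp ℂ 2 (volume : Measure (𝔼 nZ)) →L[ℂ] Lp ℂ 2 (volume : Measure (𝔼 nX)),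
      ‖T‖ ≤ A ∧ ∀ f, T f =ᵐ[volume] fun x => ∫ z, k (x, z) * f z := by
  have hmem : ∀ f : Lp ℂ 2 (volume : Measure (𝔼 nZ)), MemLp (fun x => ∫ z, k (x, z) * f z) 2
      (volume : Measure (𝔼 nX)) := fun f =>
    ⟨(stronglyMeasurable_integral_mul hk (Lp.stronglyMeasurable f).measurable).aestronglyMeasurable,
      (h f (Lp.stronglyMeasurable f).measurable (Lp.memLp f)).trans_lt
        (ENNReal.mul_lt_top (by simp) (Lp.memLp f).2)⟩
  let L : Lp ℂ 2 (volume : Measure (𝔼 nZ)) →ₗ[ℂ] Lp ℂ 2 (volume : Measure (𝔼 nX)) :=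
    { toFun := fun f => (hmem f).toLp _
      map_add' := fun f g => by
        rw [← MemLp.toLp_add]
        refine MemLp.toLp_congr _ _ (ae_of_all _ fun x => ?_)
        simp only [Pi.add_apply]
        rw [← integral_add (integrable_slice_mul hk hkc (Lp.memLp f) x)
          (integrable_slice_mul hk hkc (Lp.memLp g) x)]
        refine integral_congr_ae ?_
        filter_upwards [Lp.coeFn_add f g] with z hz
        rw [hz, Pi.add_apply, mul_add]
      map_smul' := fun c f => by
        rw [RingHom.id_apply, ← MemLp.toLp_const_smul]
        refine MemLp.toLp_congr _ _ (ae_of_all _ fun x => ?_)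
        simp only [Pi.smul_apply, smul_eq_mul]
        rw [← integral_const_mul]
        refine integral_congr_ae ?_
        filter_upwards [Lp.coeFn_smul c f] with z hz
        rw [hz, Pi.smul_apply, smul_eq_mul]
        ring }
  have hL : ∀ f, ‖L f‖ ≤ A * ‖f‖ := fun f => by
    have h1 := h f (Lp.stronglyMeasurable f).measurable (Lp.memLp f)
    have h2 : ‖L f‖ = (eLpNorm (fun x => ∫ z, k (x, z) * f z) 2 volume).toReal :=
      Lp.norm_toLp _ (hmem f)
    rw [h2, Lp.norm_def, ← ENNReal.toReal_ofReal hA, ← ENNReal.toReal_mul]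
    exact ENNReal.toReal_mono (ENNReal.mul_ne_top (by simp) (Lp.memLp f).2.ne) h1
  exact ⟨L.mkContinuous A hL, L.mkContinuous_norm_le hA hL, fun f => MemLp.coeFn_toLp (hmem f)⟩

/-- Summation of the dyadic bounds, with `2 ^ J` comparable to `lam ^ (1 / m)`. -/
theorem exists_dyadic_sum_le (n m : ℕ) (hm : 0 < m) : ∃ C : ℝ, 0 < C ∧ ∀ lam : ℝ, 2 ≤ lam →
    ∃ J : ℕ, ∀ A : ℝ, A = lam ^ (-(1 / 2) : ℝ) *
        ∑ j ∈ Finset.range J, ((2 : ℝ) ^ (((m : ℝ) - n) / 2)) ^ j +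
        ((2 : ℝ) ^ J) ^ (-((n : ℝ) / 2)) →
      (n < m → A ≤ C * lam ^ (-((n : ℝ) / (2 * (m : ℝ))))) ∧
      (m = n → A ≤ C * lam ^ (-(1 / 2) : ℝ) * Real.log lam) ∧
      (m < n → A ≤ C * lam ^ (-(1 / 2) : ℝ)) := by
  have hm' : (0 : ℝ) < m := by exact_mod_cast hm
  have hm1 : (1 : ℝ) ≤ m := by exact_mod_cast hm
  set q : ℝ := (2 : ℝ) ^ (((m : ℝ) - n) / 2) with hq
  have hq0 : 0 < q := by positivity
  have hlog2 : 0 < Real.log 2 := Real.log_pos (by norm_num)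
  -- With `L = log₂ λ`, take `J = ⌈L/m⌉`. Rounding up gives `2^J ≥ λ^(1/m)`, which controls the
  -- remainder; the excess, at most 1, costs the sum a bounded factor.
  have hJ : ∀ lam : ℝ, 2 ≤ lam → ∃ J : ℕ, ∃ L : ℝ, 1 ≤ L ∧ lam = 2 ^ L ∧
      L * Real.log 2 = Real.log lam ∧ L / m ≤ J ∧ (J : ℝ) ≤ L / m + 1 ∧
      ((2 : ℝ) ^ J) ^ (-((n : ℝ) / 2)) ≤ lam ^ (-((n : ℝ) / (2 * (m : ℝ)))) := by
    intro lam hlam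
    have hL : 1 ≤ Real.logb 2 lam := by
      rw [Real.le_logb_iff_rpow_le (by norm_num) (by linarith), Real.rpow_one]
      exact hlam
    have h2L : lam = 2 ^ Real.logb 2 lam :=
      (Real.rpow_logb (by norm_num) (by norm_num) (by linarith)).symm
    have hle := Nat.le_ceil (Real.logb 2 lam / m)
    refine ⟨⌈Real.logb 2 lam / m⌉₊, Real.logb 2 lam, hL, h2L, ?_, hle,
      (Nat.ceil_lt_add_one (by positivity)).le, ?_⟩
    · rw [Real.logb]
      field_simp
    · conv_rhs => rw [h2L]
      rw [← Real.rpow_natCast 2, ← Real.rpow_mul (by norm_num), ← Real.rpow_mul (by norm_num)]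
      refine Real.rpow_le_rpow_of_exponent_le (by norm_num) ?_
      have : Real.logb 2 lam * -((n : ℝ) / (2 * m)) = -(Real.logb 2 lam / m * (n / 2)) := by
        field_simp
      rw [this, mul_neg, neg_le_neg_iff]
      gcongr
  rcases lt_trichotomy n m with hnm | rfl | hnm
  · have hnm' : (n : ℝ) < m := by exact_mod_cast hnm
    have hq1 : 1 < q := Real.one_lt_rpow (by norm_num) (by linarith)
    have hq1' : 0 < q - 1 := by linarith
    refine ⟨q / (q - 1) + 1, by positivity, fun lam hlam => ?_⟩
    obtain ⟨J, L, hL, h2L, -, hJ1, hJ2, hrem⟩ := hJ lam hlam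
    refine ⟨J, fun A hA => ⟨fun _ => ?_, fun h => by omega, fun h => by omega⟩⟩
    -- The growing geometric sum is comparable to its largest terms: `-1/2 + (m-n)/(2m) = -n/(2m)`,
    -- and the additional `q` pays for the rounding in `J`.
    have hqJ : lam ^ (-(1 / 2) : ℝ) * q ^ J ≤ q * lam ^ (-((n : ℝ) / (2 * (m : ℝ)))) := by
      rw [h2L, hq, ← Real.rpow_natCast _ J, ← Real.rpow_mul (by norm_num),
        ← Real.rpow_mul (by norm_num), ← Real.rpow_mul (by norm_num),
        ← Real.rpow_add (by norm_num), ← Real.rpow_add (by norm_num)]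
      refine Real.rpow_le_rpow_of_exponent_le (by norm_num) ?_
      have h1 : ((m : ℝ) - n) / 2 * J ≤ ((m : ℝ) - n) / 2 * (L / m + 1) := by
        gcongr
      refine (add_le_add_right h1 _).trans (le_of_eq ?_)
      field_simp
      ring
    have hgeom : ∑ j ∈ Finset.range J, q ^ j ≤ q ^ J / (q - 1) := by
      rw [geom_sum_eq hq1.ne']
      gcongr
      linarith
    rw [hA, add_mul, one_mul]
    refine add_le_add ?_ hrem
    calc lam ^ (-(1 / 2) : ℝ) * ∑ j ∈ Finset.range J, q ^ j
        ≤ lam ^ (-(1 / 2) : ℝ) * (q ^ J / (q - 1)) := by gcongr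
      _ = lam ^ (-(1 / 2) : ℝ) * q ^ J / (q - 1) := by ring
      _ ≤ q * lam ^ (-((n : ℝ) / (2 * (m : ℝ)))) / (q - 1) := by gcongr
      _ = _ := by ring
  -- All terms equal 1. Since `L ≥ 1`, the sum is `J ≤ L + 1 ≤ 2L` and the remainder takes one more
  -- `L`; then `L = log λ / log 2`.
  · refine ⟨3 / Real.log 2, by positivity, fun lam hlam => ?_⟩
    obtain ⟨J, L, hL, h2L, hlog, hJ1, hJ2, hrem⟩ := hJ lam hlam
    refine ⟨J, fun A hA => ⟨fun h => by omega, fun _ => ?_, fun h => by omega⟩⟩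
    have hqe : q = 1 := by rw [hq, sub_self, zero_div, Real.rpow_zero]
    have hexp : (n : ℝ) / (2 * n) = 1 / 2 := by field_simp
    rw [hexp] at hrem
    have hJL : (J : ℝ) ≤ 2 * L := by
      have : L / n ≤ L := div_le_self (by linarith) hm1
      linarith
    rw [hA, hqe, ← hlog]
    simp only [one_pow, Finset.sum_const, Finset.card_range, nsmul_eq_mul, mul_one]
    have hp : 0 ≤ lam ^ (-(1 / 2) : ℝ) := by positivity
    calc _ ≤ lam ^ (-(1 / 2) : ℝ) * (2 * L) + lam ^ (-(1 / 2) : ℝ) * L := by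
          refine add_le_add (by gcongr) (hrem.trans ?_)
          exact le_mul_of_one_le_right hp hL
      _ = _ := by
        field_simp
        ring
  · have hnm' : (m : ℝ) < n := by exact_mod_cast hnm
    have hq1 : q < 1 := Real.rpow_lt_one_of_one_lt_of_neg (by norm_num) (by linarith)
    have hq1' : 0 < 1 - q := by linarith
    refine ⟨1 / (1 - q) + 1, by positivity, fun lam hlam => ?_⟩
    obtain ⟨J, L, hL, h2L, -, hJ1, hJ2, hrem⟩ := hJ lam hlam
    refine ⟨J, fun A hA => ⟨fun h => by omega, fun h => by omega, fun _ => ?_⟩⟩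
    have hgeom : ∑ j ∈ Finset.range J, q ^ j ≤ 1 / (1 - q) := by
      rw [geom_sum_eq hq1.ne, ← neg_div_neg_eq, neg_sub, neg_sub]
      gcongr
      linarith [pow_pos hq0 J]
    -- For `m < n` the remainder decays faster than `λ^(-1/2)`, so the convergent sum dominates.
    have hle : lam ^ (-((n : ℝ) / (2 * (m : ℝ)))) ≤ lam ^ (-(1 / 2) : ℝ) := by
      refine Real.rpow_le_rpow_of_exponent_le (by linarith) ?_
      rw [neg_le_neg_iff, div_le_div_iff₀ (by norm_num) (by positivity)]
      linarith
    have hp : 0 ≤ lam ^ (-(1 / 2) : ℝ) := Real.rpow_nonneg (by linarith) _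
    rw [hA, add_mul, one_mul, mul_comm (1 / (1 - q))]
    exact add_le_add (mul_le_mul_of_nonneg_left hgeom hp) (hrem.trans hle)

end OscPhase

theorem theorem1p3 (nX nZ m : ℕ) (hm : 2 ≤ m)
    (S : MvPolynomial (Fin nX ⊕ Fin nZ) ℝ) (hS : S.IsHomogeneous m)
    (hrank : OscPhase.RankOneCondition S)
    (a : EuclideanSpace ℝ (Fin nX) × EuclideanSpace ℝ (Fin nZ) → ℂ)
    (ha : ContDiff ℝ ∞ a) (hsupp : HasCompactSupport a) :
    ∃ C : ℝ, 0 < C ∧ ∀ lam : ℝ, 2 ≤ lam →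
      ∃ T : Lp ℂ 2 (volume : Measure (EuclideanSpace ℝ (Fin nZ))) →L[ℂ]
          Lp ℂ 2 (volume : Measure (EuclideanSpace ℝ (Fin nX))),
        OscPhase.IsOscOperator S a lam T ∧
        (nX + nZ < m → ‖T‖ ≤ C * lam ^ (-(((nX : ℝ) + (nZ : ℝ)) / (2 * (m : ℝ))))) ∧
        (m = nX + nZ → ‖T‖ ≤ C * lam ^ (-(1 / 2 : ℝ)) * Real.log lam) ∧
        (m < nX + nZ → ‖T‖ ≤ C * lam ^ (-(1 / 2 : ℝ))) := by
  obtain ⟨C₁, hC₁0, hC₁⟩ := OscPhase.exists_kernelBound_dyadic hS hrank ha hsupp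
  obtain ⟨C₂, hC₂0, hC₂⟩ := OscPhase.exists_dyadic_sum_le (nX + nZ) m (by omega)
  -- `C₁` may be 0; adding 1 makes the constant positive.
  refine ⟨(C₁ + 1) * C₂, by positivity, fun lam hlam => ?_⟩
  have hlam0 : 0 < lam := by linarith
  obtain ⟨J, hJ⟩ := hC₂ lam hlam
  have hB := hC₁ lam hlam0 J
  push_cast at hJ
  rw [← mul_add] at hB
  obtain ⟨h1, h2, h3⟩ := hJ _ rfl
  have hA0 : 0 ≤ lam ^ (-(1 / 2) : ℝ) *
      ∑ j ∈ Finset.range J, ((2 : ℝ) ^ (((m : ℝ) - (nX + nZ)) / 2)) ^ j +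
      ((2 : ℝ) ^ J) ^ (-(((nX : ℝ) + nZ) / 2)) := by positivity
  obtain ⟨T, hT, hTf⟩ := OscPhase.KernelBound.exists_clm
    (OscPhase.continuous_oscKernel S lam ha.continuous) hsupp.mul_left
    (mul_nonneg hC₁0 hA0) hB
  have hfin : ∀ {B : ℝ}, _ ≤ B → ‖T‖ ≤ (C₁ + 1) * B := fun {B} hAB =>
    hT.trans (mul_le_mul (by linarith) hAB hA0 (by linarith))
  refine ⟨T, hTf, fun h => (hfin (h1 h)).trans (le_of_eq (by ring)),
    fun h => (hfin (h2 h)).trans (le_of_eq (by ring)),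
    fun h => (hfin (h3 h)).trans (le_of_eq (by ring))⟩
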